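/- Definitions. For $N\in\{0,1,2,\dots\}$ let $[N]=\{1,\dots,N\}$. A feature allocation of $[N]$ is a finite multiset of non-empty subsets of $[N]$, called features. For $M\le N$, its restriction to $[M]$ is the multiset of all non-empty sets $A\cap[M]$, where $A$ runs through its features. A random feature allocation $F$ (of $\{1,2,3,\dots\}$) is a random consistent sequence $(F_N)_{N\ge 0}$, where $F_N$ is a feature allocation of $[N]$ and $F_M$ is the restriction of $F_N$ to $[M]$ for all $M\le N$; the space of such sequences carries the $\sigma$-algebra generated by the maps $F\mapsto F_N$. It is exchangeable if $\sigma(F_N)$ and $F_N$ have the same law for every $N$ and every permutation $\sigma$ of $[N]$. Let $\tilde F_N$ be the list of the features of $F_N$ (counted with multiplicity) in an order that is uniformly random given $F_N$. We say that $F$ has an exchangeable feature probability function (EFPF) if there is a function $p$, symmetric in all its arguments after the first, such that $$\mathbb P\bigl(\tilde F_N=(A_1,\dots,A_K)\bigr)=p(N,|A_1|,\dots,|A_K|)$$ for all $N$, all $K\ge 0$ and all non-empty $A_1,\dots,A_K\subseteq[N]$. Construction. Let $(V_k)_{k\ge1}$ be random variables with values in $[0,1]$ and $\sum_k V_k<\infty$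 almost surely, and let $\lambda\ge0$ be a real random variable; the joint law of $(V_k)_{k\ge 1}$ and $\lambda$ is otherwise arbitrary. Given $((V_k)_k,\lambda)$, draw independently, for all $n,k\ge1$, $X_{n,k}\sim\mathrm{Bernoulli}(V_k)$ and $Y_n\sim\mathrm{Poisson}(\lambda)$. The features of $F_N$ are the non-empty sets among $\{n\in[N]:X_{n,k}=1\}$, one for each $k\ge 1$, and in addition, for each $n\in[N]$, $Y_n$ copies of $\{n\}$. Theorem. (a) For every such joint law, the construction almost surely gives every index $n$ only finitely many features, so that it defines a random feature allocation of $\{1,2,3,\dots\}$; this random feature allocation is exchangeable and has an EFPF. (b) Conversely, every random feature allocation of $\{1,2,3,\dots\}$ that has an EFPF has the same law as one obtained by the construction for some joint law of $(V_k)_{k\ge1}$ and $\lambda$. -/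

import Mathlib

open MeasureTheory ProbabilityTheory
open scoped ENNReal NNReal

noncomputable section

/-! Throughout, the index set `[N] = {1, …, N}` is modelled by `Fin N` and the index set
`{1, 2, 3, …}` by `ℕ` (the index `n` of the text is `n - 1` here). -/

/-- A feature allocation of `[N]`: a multiset of non-empty subsets of `[N]`. (A `Multiset` is
finite, so no index belongs to infinitely many features; conversely, as `[N]` is finite, that
requirement forces the multiset to be finite.) -/
@[ext]
structure FeatureAllocation (N : ℕ) where
  features : Multiset (Finset (Fin N))
  nonempty : ∀ A ∈ features, A.Nonempty

namespace FeatureAllocation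

/-- The finite-level spaces of feature allocations are countable and discrete. -/
instance (N : ℕ) : MeasurableSpace (FeatureAllocation N) := ⊤

instance (N : ℕ) : DiscreteMeasurableSpace (FeatureAllocation N) := ⟨fun _ => trivial⟩

instance (N : ℕ) : Countable (FeatureAllocation N) :=
  Function.Injective.countable (f := FeatureAllocation.features) fun _ _ h =>
    FeatureAllocation.ext h

/-- The trace `A ∩ [M]` of a subset `A` of `[N]`, for `M ≤ N`. -/
def trace {M N : ℕ} (h : M ≤ N) (A : Finset (Fin N)) : Finset (Fin M) :=
  Finset.univ.filter fun i => Fin.castLE h i ∈ A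

/-- The restriction of a feature allocation of `[N]` to `[M]`: the multiset of all non-empty
`A ∩ [M]`, where `A` runs through the features. -/
def restrict {M N : ℕ} (h : M ≤ N) (F : FeatureAllocation N) : FeatureAllocation M where
  features := (F.features.map (trace h)).filter Finset.Nonempty
  nonempty := fun _ hA => (Multiset.mem_filter.1 hA).2

/-- The image `σ(F) = {σ(A) : A ∈ F}` of a feature allocation under a permutation of `[N]`. -/
def permute {N : ℕ} (σ : Equiv.Perm (Fin N)) (F : FeatureAllocation N) : FeatureAllocation N where
  features := F.features.map fun A => A.map σ.toEmbedding
  nonempty := fun B hB => by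
    obtain ⟨A, hA, rfl⟩ := Multiset.mem_map.1 hB
    exact (F.nonempty A hA).map

theorem lists_ne_zero {α : Type*} (s : Multiset α) : s.lists ≠ 0 := by
  induction s using Quotient.inductionOn with
  | h l =>
    intro h
    have : l ∈ (Multiset.lists (l : Multiset α)) := by simp
    rw [show Multiset.lists (l : Multiset α) = 0 from h] at this
    simp at this

/-- The uniformly random ordering of the features of `F`: each of the `K!` ways of listing the
`K` features (counted with multiplicity) is equally likely. -/
def randomOrdering {N : ℕ} (F : FeatureAllocation N) : PMF (List (Finset (Fin N))) :=
  PMF.ofMultiset F.features.lists (lists_ne_zero F.features)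

end FeatureAllocation

/-- A feature allocation of `{1, 2, 3, …}`: a consistent sequence of feature allocations of
`[N]`, `N = 0, 1, 2, …`. -/
@[ext]
structure FeatureAllocationSeq where
  level : ∀ N : ℕ, FeatureAllocation N
  consistent : ∀ (M N : ℕ) (h : M ≤ N), (level N).restrict h = level M

namespace FeatureAllocationSeq

/-- The σ-algebra generated by the finite restrictions. -/
instance : MeasurableSpace FeatureAllocationSeq :=
  ⨆ N : ℕ, MeasurableSpace.comap (fun F : FeatureAllocationSeq => F.level N) inferInstance

theorem measurable_level (N : ℕ) : Measurable fun F : FeatureAllocationSeq => F.level N :=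
  Measurable.of_comap_le
    (le_iSup (fun N : ℕ => MeasurableSpace.comap
      (fun F : FeatureAllocationSeq => F.level N) inferInstance) N)

theorem measurable_of_level {Ω : Type*} [MeasurableSpace Ω] {f : Ω → FeatureAllocationSeq}
    (hf : ∀ N, Measurable fun ω => (f ω).level N) : Measurable f := by
  refine Measurable.of_le_map (iSup_le fun N => ?_)
  rw [MeasurableSpace.comap_le_iff_le_map, MeasurableSpace.map_comp]
  exact (hf N).le_map

/-- `μ`, the law of a random feature allocation `F` of `{1, 2, 3, …}`, is exchangeable: for every
`N` and every permutation `σ` of `[N]`, the restriction `F_N` and `σ(F_N)` have the same law. -/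
def IsExchangeable (μ : Measure FeatureAllocationSeq) : Prop :=
  ∀ (N : ℕ) (σ : Equiv.Perm (Fin N)),
    μ.map (fun F => (F.level N).permute σ) = μ.map (fun F => F.level N)

/-- The probability that the uniformly ordered restriction to `[N]` of a random feature allocation
with law `μ` equals the list `l`: given the restriction `F_N`, its ordering has the
law `randomOrdering`. -/
def orderedProb (μ : Measure FeatureAllocationSeq) (N : ℕ) (l : List (Finset (Fin N))) : ℝ≥0∞ :=
  ∫⁻ F, (F.level N).randomOrdering l ∂μ

/-- A random feature allocation with law `μ` has an exchangeable feature probability function: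
there is a function `p`, symmetric in all arguments after the first, such that for all `N` the
uniformly ordered restriction to `[N]` equals `(A₁, …, A_K)` with probability
`p(N, |A₁|, …, |A_K|)`, for every finite list of non-empty subsets of `[N]`. -/
def HasEFPF (μ : Measure FeatureAllocationSeq) : Prop :=
  ∃ p : ℕ → List ℕ → ℝ≥0∞,
    (∀ (N : ℕ) (m m' : List ℕ), m.Perm m' → p N m = p N m') ∧
    ∀ (N : ℕ) (l : List (Finset (Fin N))), (∀ A ∈ l, A.Nonempty) →
      orderedProb μ N l = p N (l.map Finset.card)

end FeatureAllocationSeq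

/-! ### Feature frequency models with additional Poisson singletons -/

namespace FeatureFrequency

/-- The mixing parameters: the frequencies `(V_k)`, with values in `[0,1]`, and the rate
`λ ≥ 0`. -/
abbrev Param : Type := (ℕ → unitInterval) × ℝ≥0

/-- The draws made for all indices `n`: for each `k` whether the Bernoulli draw for the feature `k`
is a success, and the number of additional singleton features `{n}`. -/
abbrev Sample : Type := ℕ → (ℕ → Bool) × ℕ

/-- The law, given the parameters, of the draws made for one index: Bernoulli(`V_k`) draws for all
`k` and a Poisson(`λ`) draw, all independent. -/
def indexLaw (θ : Param) : Measure ((ℕ → Bool) × ℕ) :=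
  (Measure.infinitePi fun k => bernoulliMeasure true false (θ.1 k)).prod (poissonMeasure θ.2)

instance (θ : Param) : IsProbabilityMeasure (indexLaw θ) := by
  unfold indexLaw; infer_instance

/-- The law of all the draws given the parameters: independent over the indices. -/
def sampleLaw (θ : Param) : Measure Sample :=
  Measure.infinitePi fun _ => indexLaw θ

instance (θ : Param) : IsProbabilityMeasure (sampleLaw θ) := by
  unfold sampleLaw; infer_instance

theorem measurable_infinitePi {Θ ι : Type*} [MeasurableSpace Θ] {X : ι → Type*}
    [∀ i, MeasurableSpace (X i)] (ν : Θ → ∀ i, Measure (X i))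
    [∀ θ i, IsProbabilityMeasure (ν θ i)] (hν : ∀ i, Measurable fun θ => ν θ i) :
    Measurable fun θ => Measure.infinitePi (ν θ) := by
  refine .measure_of_isPiSystem_of_isProbabilityMeasure
    (generateFrom_squareCylinders).symm
    (isPiSystem_squareCylinders (fun i => MeasurableSpace.isPiSystem_measurableSet)
      (fun i => MeasurableSet.univ)) ?_
  rintro _ ⟨s, t, ht, rfl⟩
  have hm : ∀ i, MeasurableSet (t i) := fun i => ht i (Set.mem_univ i)
  simp_rw [Measure.infinitePi_pi _ (fun i _ => hm i)]
  exact Finset.measurable_prod _ fun i _ => (Measure.measurable_coe (hm i)).comp (hν i)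

theorem measurable_bernoulliMeasure :
    Measurable fun p : unitInterval => bernoulliMeasure true false p := by
  refine Measure.measurable_of_measurable_coe _ fun s hs => ?_
  simp only [bernoulliMeasure, Measure.add_apply, Measure.smul_apply]
  refine Measurable.add ?_ ?_
  · exact (((by unfold unitInterval.toNNReal; fun_prop :
      Measurable fun p : unitInterval => unitInterval.toNNReal p)).coe_nnreal_ennreal).mul_const _
  · exact (((by unfold unitInterval.toNNReal; fun_prop :
      Measurable fun p : unitInterval => unitInterval.toNNReal p).comp
        unitInterval.measurable_symm).coe_nnreal_ennreal).mul_const _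

theorem measurable_poissonMeasure : Measurable poissonMeasure := by
  refine Measure.measurable_of_measurable_coe _ fun s hs => ?_
  simp only [poissonMeasure, Measure.sum_apply _ hs, Measure.smul_apply, smul_eq_mul]
  fun_prop

theorem measurable_indexLaw : Measurable indexLaw := by
  have h1 : Measurable fun θ : Param =>
      Measure.infinitePi fun k => bernoulliMeasure true false (θ.1 k) :=
    measurable_infinitePi (fun (θ : Param) k => bernoulliMeasure true false (θ.1 k)) fun k =>
      measurable_bernoulliMeasure.comp (by fun_prop)
  have h2 : Measurable fun θ : Param => poissonMeasure θ.2 :=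
    measurable_poissonMeasure.comp measurable_snd
  refine .measure_of_isPiSystem_of_isProbabilityMeasure generateFrom_prod.symm isPiSystem_prod ?_
  rintro _ ⟨s, hs, t, ht, rfl⟩
  simp only [indexLaw, Measure.prod_prod]
  exact ((Measure.measurable_coe (show MeasurableSet s from hs)).comp h1).mul
    ((Measure.measurable_coe (show MeasurableSet t from ht)).comp h2)

theorem measurable_sampleLaw : Measurable sampleLaw :=
  measurable_infinitePi (fun (θ : Param) (_ : ℕ) => indexLaw θ) fun _ => measurable_indexLaw

/-- The law of the draws given the parameters, as a Markov kernel. -/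
def sampleKernel : Kernel Param Sample := ⟨sampleLaw, measurable_sampleLaw⟩

instance : IsMarkovKernel sampleKernel :=
  ⟨fun θ => inferInstanceAs (IsProbabilityMeasure (sampleLaw θ))⟩

/-- Every index has finitely many successful Bernoulli draws. (Almost sure if the frequencies have
an almost surely finite sum.) -/
def LocallyFinite (ω : Sample) : Prop := ∀ n, {k | (ω n).1 k = true}.Finite

/-- The feature indexed by `k`, intersected with `[N]`. -/
def block (ω : Sample) (N k : ℕ) : Finset (Fin N) :=
  Finset.univ.filter fun i => (ω i).1 k = true

theorem finite_block {ω : Sample} (hω : LocallyFinite ω) (N : ℕ) :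
    {k | (block ω N k).Nonempty}.Finite := by
  refine (Set.finite_iUnion fun i : Fin N => hω i).subset ?_
  rintro k ⟨i, hi⟩
  exact Set.mem_iUnion.2 ⟨i, by simpa [block] using hi⟩

/-- The features of `[N]` obtained from the draws: the non-empty sets among the
`{n ∈ [N] : the draw of n for k is a success}`, one for each `k`, and in addition, for each `n`,
as many copies of `{n}` as the Poisson draw says. -/
def generatedFeatures (ω : Sample) (hω : LocallyFinite ω) (N : ℕ) : Multiset (Finset (Fin N)) :=
  (finite_block hω N).toFinset.val.map (block ω N) +
    ∑ i : Fin N, Multiset.replicate (ω i).2 {i}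

theorem trace_block (ω : Sample) {M N : ℕ} (h : M ≤ N) (k : ℕ) :
    FeatureAllocation.trace h (block ω N k) = block ω M k := by
  ext i; simp [FeatureAllocation.trace, block]

theorem generatedFeatures_restrict (ω : Sample) (hω : LocallyFinite ω) {M N : ℕ} (h : M ≤ N) :
    ((generatedFeatures ω hω N).map (FeatureAllocation.trace h)).filter Finset.Nonempty =
      generatedFeatures ω hω M := by
  classical
  unfold generatedFeatures
  rw [Multiset.map_add, Multiset.filter_add]
  congr 1
  · rw [Multiset.map_map, Multiset.filter_map]
    simp only [Function.comp_def, trace_block]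
    congr 1
    rw [← Finset.filter_val]
    congr 1
    ext k
    simp only [Finset.mem_filter, Set.Finite.mem_toFinset, Set.mem_ofPred_eq, and_iff_right_iff_imp]
    rintro ⟨i, hi⟩
    exact ⟨Fin.castLE h i, by simpa [block] using hi⟩
  · let φ : Multiset (Finset (Fin N)) →+ Multiset (Finset (Fin M)) :=
      { toFun := fun s => (s.map (FeatureAllocation.trace h)).filter Finset.Nonempty
        map_zero' := by simp
        map_add' := by simp }
    have hφ : ∀ s, φ s = (s.map (FeatureAllocation.trace h)).filter Finset.Nonempty :=
      fun _ => rfl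
    change φ _ = _
    rw [map_sum]
    symm
    refine Finset.sum_of_injOn (Fin.castLE h) (Fin.castLE_injective h).injOn (by simp) ?_ ?_
    · intro i _ hi
      have he : FeatureAllocation.trace h {i} = ∅ := by
        ext j
        simp only [FeatureAllocation.trace, Finset.mem_filter, Finset.mem_univ, true_and,
          Finset.mem_singleton, Finset.notMem_empty, iff_false]
        rintro rfl
        exact hi ⟨j, by simp⟩
      rw [hφ, Multiset.map_replicate, he, Multiset.filter_eq_nil]
      intro A hA
      rw [Multiset.eq_of_mem_replicate hA]
      exact Finset.not_nonempty_empty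
    · intro i _
      have he : FeatureAllocation.trace h {Fin.castLE h i} = {i} := by
        ext j
        simp [FeatureAllocation.trace]
      have hf : (Multiset.replicate (ω (i : ℕ)).2 ({i} : Finset (Fin M))).filter Finset.Nonempty =
          Multiset.replicate (ω (i : ℕ)).2 {i} :=
        Multiset.filter_eq_self.2 fun A hA => by
          rw [Multiset.eq_of_mem_replicate hA]; exact Finset.singleton_nonempty i
      rw [hφ, Multiset.map_replicate, he]
      exact hf.symm

/-- The feature allocation of `{1, 2, 3, …}` obtained from locally finite draws. -/
def generated (ω : Sample) (hω : LocallyFinite ω) : FeatureAllocationSeq where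
  level N :=
    { features := generatedFeatures ω hω N
      nonempty := fun A hA => by
        rcases Multiset.mem_add.1 hA with hA | hA
        · obtain ⟨k, hk, rfl⟩ := Multiset.mem_map.1 hA
          simpa using hk
        · obtain ⟨i, -, hi⟩ := Multiset.mem_sum.1 hA
          rw [Multiset.eq_of_mem_replicate hi]
          exact Finset.singleton_nonempty i }
  consistent M N h := FeatureAllocation.ext (generatedFeatures_restrict ω hω h)

/-- The feature allocation without features. -/
def emptyAllocation : FeatureAllocationSeq where
  level _ := ⟨0, by simp⟩
  consistent M N h := by simp [FeatureAllocation.restrict]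

open Classical in
/-- The feature allocation obtained from the draws; the value on draws that are not locally finite
is irrelevant. -/
def allocation (ω : Sample) : FeatureAllocationSeq :=
  if hω : LocallyFinite ω then generated ω hω else emptyAllocation

theorem measurableSet_locallyFinite : MeasurableSet {ω : Sample | LocallyFinite ω} := by
  have : {ω : Sample | LocallyFinite ω} =
      ⋂ n : ℕ, ⋃ K : ℕ, ⋂ k : ℕ, {ω | K ≤ k → (ω n).1 k = false} := by
    ext ω
    simp only [LocallyFinite, Set.mem_ofPred_eq, Set.mem_iInter, Set.mem_iUnion]
    refine forall_congr' fun n => ⟨fun h => ?_, fun ⟨K, hK⟩ => ?_⟩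
    · obtain ⟨K, hK⟩ := h.bddAbove
      refine ⟨K + 1, fun k hk => ?_⟩
      by_contra hc
      have := hK (show k ∈ {k | (ω n).1 k = true} by simpa using hc)
      omega
    · refine (Set.finite_lt_nat K).subset fun k hk => ?_
      by_contra hc
      have := hK k (by simpa using hc)
      simp_all
  rw [this]
  refine .iInter fun n => .iUnion fun K => .iInter fun k => ?_
  by_cases h : K ≤ k
  · simp only [h, true_imp_iff]
    exact measurableSet_eq_fun (by fun_prop) measurable_const
  · simp [h]

theorem generated_level_eq_iff (ω : Sample) (hω : LocallyFinite ω) (N : ℕ)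
    (F : FeatureAllocation N) :
    (generated ω hω).level N = F ↔ ∃ K₀ : ℕ, ∀ K, K₀ ≤ K →
      ((Finset.range K).filter fun k => (block ω N k).Nonempty).val.map (block ω N) +
        ∑ i : Fin N, Multiset.replicate (ω i).2 {i} = F.features := by
  obtain ⟨B, hB⟩ := (finite_block hω N).bddAbove
  have key : ∀ K, B + 1 ≤ K →
      ((Finset.range K).filter fun k => (block ω N k).Nonempty) =
        (finite_block hω N).toFinset := by
    intro K hK
    ext k
    simp only [Finset.mem_filter, Finset.mem_range, Set.Finite.mem_toFinset, Set.mem_ofPred_eq,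
      and_iff_right_iff_imp]
    intro hk
    have : k ≤ B := hB hk
    omega
  rw [FeatureAllocation.ext_iff]
  change generatedFeatures ω hω N = F.features ↔ _
  unfold generatedFeatures
  constructor
  · intro h
    exact ⟨B + 1, fun K hK => by rw [key K hK]; exact h⟩
  · rintro ⟨K₀, h⟩
    have := h (max K₀ (B + 1)) (le_max_left _ _)
    rwa [key _ (le_max_right _ _)] at this

theorem measurable_allocation : Measurable allocation := by
  classical
  refine FeatureAllocationSeq.measurable_of_level fun N => measurable_to_countable' fun F => ?_
  have hT : ∀ K : ℕ, MeasurableSet {ω : Sample |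
      ((Finset.range K).filter fun k => (block ω N k).Nonempty).val.map (block ω N) +
        ∑ i : Fin N, Multiset.replicate (ω i).2 {i} = F.features} := by
    intro K
    let π : Sample → (Fin N → (Fin K → Bool) × ℕ) :=
      fun ω i => (fun k => (ω i).1 k, (ω i).2)
    have hπ : Measurable π := by fun_prop
    let ext : (Fin N → (Fin K → Bool) × ℕ) → Sample := fun x n =>
      if hn : n < N then (fun k => if hk : k < K then (x ⟨n, hn⟩).1 ⟨k, hk⟩ else false,
        (x ⟨n, hn⟩).2) else (fun _ => false, 0)
    have hb : ∀ (ω : Sample), ∀ k < K, block (ext (π ω)) N k = block ω N k := by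
      intro ω k hk
      ext i
      simp [block, ext, π, hk]
    have hs : {ω : Sample |
        ((Finset.range K).filter fun k => (block ω N k).Nonempty).val.map (block ω N) +
          ∑ i : Fin N, Multiset.replicate (ω i).2 {i} = F.features} = π ⁻¹' {x |
        ((Finset.range K).filter fun k => (block (ext x) N k).Nonempty).val.map
          (block (ext x) N) +
          ∑ i : Fin N, Multiset.replicate (x i).2 {i} = F.features} := by
      ext ω
      have h1 : ((Finset.range K).filter fun k => (block (ext (π ω)) N k).Nonempty) =
          (Finset.range K).filter fun k => (block ω N k).Nonempty :=
        Finset.filter_congr fun k hk => by rw [hb ω k (Finset.mem_range.1 hk)]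
      have h2 : ((Finset.range K).filter fun k => (block ω N k).Nonempty).val.map
          (block (ext (π ω)) N) =
          ((Finset.range K).filter fun k => (block ω N k).Nonempty).val.map (block ω N) :=
        Multiset.map_congr rfl fun k hk =>
          hb ω k (Finset.mem_range.1 (Finset.mem_filter.1 hk).1)
      simp only [Set.mem_ofPred_eq, Set.mem_preimage, h1, h2]
      rfl
    rw [hs]
    exact hπ (.of_discrete)
  have hset : (fun ω => (allocation ω).level N) ⁻¹' {F} =
      ({ω | LocallyFinite ω} ∩ ⋃ K₀ : ℕ, ⋂ K : ℕ, ⋂ _ : K₀ ≤ K, {ω : Sample |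
        ((Finset.range K).filter fun k => (block ω N k).Nonempty).val.map (block ω N) +
          ∑ i : Fin N, Multiset.replicate (ω i).2 {i} = F.features}) ∪
      ({ω | LocallyFinite ω}ᶜ ∩ {_ω | emptyAllocation.level N = F}) := by
    ext ω
    by_cases h : LocallyFinite ω
    · simp [allocation, h, generated_level_eq_iff]
    · simp [allocation, h]
  rw [hset]
  exact (measurableSet_locallyFinite.inter (.iUnion fun K₀ => .iInter fun K => .iInter fun _ =>
    hT K)).union (measurableSet_locallyFinite.compl.inter (.const _))

/-- The law of the feature allocation generated by a feature frequency model with additional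
Poisson singletons, when `Q` is the joint law of the frequencies `(V_k)` and of `λ`. -/
def allocationLaw (Q : Measure Param) : Measure FeatureAllocationSeq :=
  (Q.bind sampleKernel).map allocation

/-- `Q` is a legitimate joint law of the frequencies `(V_k)` and of `λ`: a probability measure
under which the frequencies have an almost surely finite sum. -/
structure IsParamLaw (Q : Measure Param) : Prop where
  isProbabilityMeasure : IsProbabilityMeasure Q
  summable : ∀ᵐ θ ∂Q, Summable fun k => (θ.1 k : ℝ)

end FeatureFrequency

end

/-! Everything is expressed through the probability generating functional `t ↦ E ∏_{A ∈ F_N} t A`,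
where `t ∅ = 1` and `0 < t A < 1` for non-empty `A`. These products are closed under multiplication
and separate points, so the functional determines the law of `F_N` (`measure_ext_of_weight`). Having
an EFPF then amounts to invariance of the functional under replacing `t` by its averages over sets
of equal size (`HasEFPF.integral_weight_sizeAverage`, `hasEFPF_of_sizeAverage`).

Part (a). Given the parameters, independence turns the functional into `∏ bern t (V_k) · exp (-λ
a)`, where `a = ∑ (1 - t {i})`. This involves `t` only through its sums over the sets of each size,
which neither a permutation of `[N]` nor size averaging changes.

Part (b). By consistency, `weight t` of `F_M` is `weight (t ∘ trace)` of `F_N`, and the EFPF allows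
`t ∘ trace` to be size averaged. Each feature `A` of `[N]` is thereby replaced by a uniformly random
set of the same size, whose trace on `[M]` is a sample without replacement; for large `N` it is
nearly a Bernoulli sample with success probability `|A| / N`. So the functional of `F_M` is close to
`E ∏ bern t (|A| / N)`, the functional of the construction at the empirical frequencies
(`tendsto_integral_limitWeight`).

To pass to the limit, write `∏ bern t (v_k) = exp (-a S) · exp (∑ logBern t (v_k))` with `S = ∑
v_k`. Since `logBern t v = O(v²)`, the second factor survives limits, whereas `S` may exceed the sum
of the limiting frequencies, because features of vanishing frequency keep a positive total. Hence `u
= exp (-S)` is kept as a separate coordinate beside the decreasing frequencies. The resulting space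
is compact and the functional is continuous on it (`continuousOn_limitWeight`), so the laws of the
empirical parameters have a limit point `Q`. The lost mass `S - ∑ v_k` is the Poisson rate `λ`, and
`S < ∞` almost surely because `F_1` has finitely many features (`ae_pos_of_limit_law`). -/

noncomputable section

/-! ### Generating functionals determine laws -/

namespace FeatureAllocation

/-- The multiplicative functional `F ↦ ∏_{A ∈ F} t A`. -/
def weight {N : ℕ} (t : Finset (Fin N) → ℝ) (F : FeatureAllocation N) : ℝ :=
  (F.features.map t).prod

/-- Functions on subsets of `[N]` with values in `(0, 1]` which take the value `1` at the empty
set. -/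
structure IsWeight {N : ℕ} (t : Finset (Fin N) → ℝ) : Prop where
  empty : t ∅ = 1
  pos : ∀ A, 0 < t A
  le_one : ∀ A, t A ≤ 1

/-- Functions on subsets of `[N]` which take the value `1` at the empty set, and values strictly
between `0` and `1` at the non-empty sets. -/
structure IsTest {N : ℕ} (t : Finset (Fin N) → ℝ) : Prop extends IsWeight t where
  lt_one : ∀ A, A.Nonempty → t A < 1

variable {N : ℕ} {t t' : Finset (Fin N) → ℝ}

theorem IsTest.mul (h : IsTest t) (h' : IsTest t') : IsTest (t * t') where
  empty := by simp [h.empty, h'.empty]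
  pos A := mul_pos (h.pos A) (h'.pos A)
  le_one A := mul_le_one₀ (h.le_one A) (h'.pos A).le (h'.le_one A)
  lt_one A hA := mul_lt_one_of_nonneg_of_lt_one_left (h.pos A).le (h.lt_one A hA) (h'.le_one A)

theorem weight_mul (F : FeatureAllocation N) : weight (t * t') F = weight t F * weight t' F := by
  simp [weight, Multiset.prod_map_mul]

theorem IsWeight.weight_nonneg (h : IsWeight t) (F : FeatureAllocation N) : 0 ≤ weight t F := by
  refine Multiset.prod_nonneg fun x hx => ?_
  obtain ⟨A, -, rfl⟩ := Multiset.mem_map.1 hx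
  exact (h.pos A).le

theorem multiset_prod_map_le_one {α : Type*} {f : α → ℝ} (h0 : ∀ a, 0 ≤ f a) (h1 : ∀ a, f a ≤ 1)
    (s : Multiset α) : (s.map f).prod ≤ 1 := by
  induction s using Multiset.induction with
  | empty => simp
  | cons a s ih =>
    rw [Multiset.map_cons, Multiset.prod_cons]
    refine mul_le_one₀ (h1 a) (Multiset.prod_nonneg fun x hx => ?_) ih
    obtain ⟨b, -, rfl⟩ := Multiset.mem_map.1 hx
    exact h0 b

theorem IsWeight.weight_le_one (h : IsWeight t) (F : FeatureAllocation N) : weight t F ≤ 1 :=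
  multiset_prod_map_le_one (fun A => (h.pos A).le) h.le_one _

theorem IsWeight.norm_weight_le_one (h : IsWeight t) (F : FeatureAllocation N) :
    ‖weight t F‖ ≤ 1 := by
  rw [Real.norm_eq_abs, abs_of_nonneg (h.weight_nonneg F)]
  exact h.weight_le_one F

theorem IsWeight.integrable_weight (h : IsWeight t) (α : Measure (FeatureAllocation N))
    [IsFiniteMeasure α] : Integrable (weight t) α :=
  .of_bound (Measurable.of_discrete.aestronglyMeasurable) 1 (ae_of_all _ h.norm_weight_le_one)

/-- Features that miss `[M]` disappear under restriction, and on the other side they contribute the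
factor `t ∅ = 1`. -/
theorem weight_restrict {M N : ℕ} (h : M ≤ N) {t : Finset (Fin M) → ℝ} (ht : t ∅ = 1)
    (F : FeatureAllocation N) : weight t (F.restrict h) = weight (t ∘ trace h) F := by
  classical
  have key : ∀ s : Multiset (Finset (Fin M)),
      ((s.filter Finset.Nonempty).map t).prod = (s.map t).prod := by
    intro s
    induction s using Multiset.induction with
    | empty => simp
    | cons a s ih =>
      by_cases ha : a.Nonempty
      · simp [Multiset.filter_cons_of_pos _ ha, ih]
      · rw [Multiset.filter_cons_of_neg _ ha, ih, Finset.not_nonempty_iff_eq_empty.1 ha]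
        simp [ht]
  simp only [weight, restrict]
  rw [show (F.features.map (t ∘ trace h)) = (F.features.map (trace h)).map t by
    rw [Multiset.map_map]]
  convert key (F.features.map (trace h)) using 3

open Classical in
/-- Test functions that separate the feature allocations that differ in the multiplicity
of `A`. -/
def separatingTest (c : ℝ) (A : Finset (Fin N)) : Finset (Fin N) → ℝ :=
  fun B => if B = ∅ then 1 else if B = A then c else 1 / 2

theorem isTest_separatingTest {c : ℝ} (h0 : 0 < c) (h1 : c < 1) (A : Finset (Fin N)) :
    IsTest (separatingTest c A) where
  empty := by simp [separatingTest]
  pos B := by unfold separatingTest; split_ifs <;> first | assumption | norm_num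
  le_one B := by unfold separatingTest; split_ifs <;> first | exact h1.le | norm_num
  lt_one B hB := by
    unfold separatingTest; rw [if_neg hB.ne_empty]; split_ifs <;> first | assumption | norm_num

open Classical in
theorem weight_separatingTest (c : ℝ) (A : Finset (Fin N)) (F : FeatureAllocation N) :
    weight (separatingTest c A) F =
      c ^ F.features.count A * (1 / 2) ^ (F.features.filter (· ≠ A)).card := by
  have key : ∀ s : Multiset (Finset (Fin N)), (∀ B ∈ s, B.Nonempty) →
      (s.map (separatingTest c A)).prod =
        c ^ s.count A * (1 / 2) ^ (s.filter (· ≠ A)).card := by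
    intro s hs
    induction s using Multiset.induction with
    | empty => simp
    | cons a s ih =>
      have h := ih fun B hB => hs B (Multiset.mem_cons_of_mem hB)
      have ha : a ≠ ∅ := (hs a (Multiset.mem_cons_self a s)).ne_empty
      by_cases haA : a = A
      · subst haA
        rw [Multiset.map_cons, Multiset.prod_cons, h, Multiset.count_cons_self,
          Multiset.filter_cons_of_neg (p := (· ≠ a)) _ (by simp)]
        simp only [separatingTest, if_neg ha, if_true]
        ring
      · rw [Multiset.map_cons, Multiset.prod_cons, h, Multiset.count_cons_of_ne (Ne.symm haA),
          Multiset.filter_cons_of_pos (p := (· ≠ A)) _ haA, Multiset.card_cons]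
        simp only [separatingTest, if_neg ha, if_neg haA]
        ring
  exact key F.features F.nonempty

/-- With value `1/2` at `A` the functional reveals the total number of features; with value `1/4`
each copy of `A` counts twice in the exponent. The difference of the two exponents is the
multiplicity of `A`. -/
theorem eq_of_weight_eq {F G : FeatureAllocation N} (h : ∀ t, IsTest t → weight t F = weight t G) :
    F = G := by
  classical
  refine FeatureAllocation.ext (Multiset.ext.2 fun A => ?_)
  have h2 := h _ (isTest_separatingTest (c := 1 / 2) (by norm_num) (by norm_num) A)
  have h4 := h _ (isTest_separatingTest (c := 1 / 4) (by norm_num) (by norm_num) A)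
  rw [weight_separatingTest, weight_separatingTest] at h2 h4
  rw [← pow_add, ← pow_add] at h2
  have e1 := pow_right_injective₀ (a := (1 / 2 : ℝ)) (by norm_num) (by norm_num) h2
  rw [show (1 / 4 : ℝ) = (1 / 2) ^ 2 by norm_num, ← pow_mul, ← pow_mul, ← pow_add, ← pow_add] at h4
  have e2 := pow_right_injective₀ (a := (1 / 2 : ℝ)) (by norm_num) (by norm_num) h4
  omega

/-- A law on feature allocations of `[N]` is determined by its probability generating
functional. -/
theorem measure_ext_of_weight {α β : Measure (FeatureAllocation N)} [IsProbabilityMeasure α]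
    [IsProbabilityMeasure β]
    (h : ∀ t, IsTest t → ∫ F, weight t F ∂α = ∫ F, weight t F ∂β) : α = β := by
  let : TopologicalSpace (FeatureAllocation N) := ⊥
  have : DiscreteTopology (FeatureAllocation N) := ⟨rfl⟩
  let f : ∀ t : Finset (Fin N) → ℝ, IsTest t →
      BoundedContinuousFunction (FeatureAllocation N) ℝ := fun t ht =>
    BoundedContinuousFunction.ofNormedAddCommGroupDiscrete (weight t) 1 ht.norm_weight_le_one
  let S : Set (BoundedContinuousFunction (FeatureAllocation N) ℝ) :=
    {g | ∃ t ht, g = f t ht}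
  let A : StarSubalgebra ℝ (BoundedContinuousFunction (FeatureAllocation N) ℝ) :=
    { Algebra.adjoin ℝ S with
      star_mem' := by
        intro a ha
        have : star a = a := by ext x; simp
        rw [this]; exact ha }
  -- A countable discrete space is Polish, so it suffices that the algebra generated by the
  -- functionals separates points and that the integrals agree on it.
  refine ext_of_forall_mem_subalgebra_integral_eq_of_polish (𝕜 := ℝ) (A := A) ?_ ?_
  · intro F G hFG
    by_contra hc
    refine hFG (eq_of_weight_eq fun t ht => ?_)
    by_contra hne
    refine hc ⟨f t ht, ⟨(f t ht).toContinuousMap, ⟨f t ht, ?_, rfl⟩, rfl⟩, hne⟩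
    exact Algebra.subset_adjoin ⟨t, ht, rfl⟩
  · intro g hg
    have hg' : g ∈ Submodule.span ℝ (Submonoid.closure S : Set _) := by
      rw [← Algebra.adjoin_eq_span]; exact hg
    -- Products of tests are tests, so the generated algebra is merely the linear span of `1` and
    -- the functionals.
    have hmul : ∀ g ∈ Submonoid.closure S, g = 1 ∨ g ∈ S := by
      intro g hg
      induction hg using Submonoid.closure_induction with
      | mem x hx => exact Or.inr hx
      | one => exact Or.inl rfl
      | mul x y _ _ hx hy =>
        rcases hx with rfl | ⟨t, ht, rfl⟩
        · simpa using hy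
        · rcases hy with rfl | ⟨t', ht', rfl⟩
          · exact Or.inr ⟨t, ht, by simp⟩
          · refine Or.inr ⟨t * t', ht.mul ht', ?_⟩
            ext F
            exact (weight_mul F).symm
    clear hg
    induction hg' using Submodule.span_induction with
    | mem x hx =>
      rcases hmul x hx with rfl | ⟨t, ht, rfl⟩
      · simp
      · exact h t ht
    | zero => simp
    | add x y _ _ hx hy =>
      simp only [BoundedContinuousFunction.coe_add, Pi.add_apply]
      rw [integral_add (x.integrable _) (y.integrable _),
        integral_add (x.integrable _) (y.integrable _), hx, hy]
    | smul c x _ hx =>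
      simp only [BoundedContinuousFunction.coe_smul, integral_smul, hx]

end FeatureAllocation

namespace FeatureAllocationSeq

/-- The law of a random feature allocation is determined by the laws of its restrictions to `[N]`
for `N ≥ 1`. -/
theorem measure_ext_of_level {μ ν : Measure FeatureAllocationSeq} [IsProbabilityMeasure μ]
    [IsProbabilityMeasure ν]
    (h : ∀ N, 1 ≤ N → μ.map (fun F => F.level N) = ν.map (fun F => F.level N)) : μ = ν := by
  let m : ℕ → MeasurableSpace FeatureAllocationSeq := fun N =>
    MeasurableSpace.comap (fun F : FeatureAllocationSeq => F.level N) inferInstance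
  have hm : Monotone m := by
    intro M N hMN s hs
    obtain ⟨u, -, rfl⟩ := hs
    refine ⟨(fun F => F.restrict hMN) ⁻¹' u, trivial, ?_⟩
    ext F
    simp [F.consistent M N hMN]
  refine MeasureTheory.ext_of_generate_finite (⋃ N, {s | MeasurableSet[m N] s}) ?_ ?_ ?_ (by simp)
  · exact (MeasurableSpace.generateFrom_iUnion_measurableSet m).symm
  · exact isPiSystem_iUnion_of_monotone _
      (fun N => @MeasurableSpace.isPiSystem_measurableSet _ (m N)) hm
  · intro s hs
    obtain ⟨N, hN⟩ := Set.mem_iUnion.1 hs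
    -- The event is moved up to level `N + 1`, since the hypothesis says nothing about level `0`.
    obtain ⟨u, -, rfl⟩ := hm (Nat.le_succ N) s hN
    have h1 := congrArg (fun ρ => ρ u) (h (N + 1) (by omega))
    simpa only [Measure.map_apply (measurable_level (N + 1)) (MeasurableSet.of_discrete (s := u))]
      using h1

end FeatureAllocationSeq

/-! ### The number of times a list occurs among the orderings of a multiset -/

namespace ListOrderings

open List

variable {α : Type*} [DecidableEq α]

/-- All lists obtained from a list by deleting one occurrence of `x`. -/
def eraseEach (x : α) : List α → List (List α)
  | [] => []
  | z :: l => (if z = x then [l] else []) ++ (eraseEach x l).map (cons z)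

theorem cons_perm_of_mem_eraseEach {x : α} {l e : List α} (he : e ∈ eraseEach x l) :
    (x :: e).Perm l := by
  induction l generalizing e with
  | nil => simp [eraseEach] at he
  | cons z l ih =>
    rw [eraseEach, mem_append] at he
    rcases he with he | he
    · split_ifs at he with hz
      · simp only [mem_singleton] at he
        rw [he, hz]
      · simp at he
    · obtain ⟨e', he', rfl⟩ := mem_map.1 he
      exact (Perm.swap z x e').trans ((ih he').cons z)

theorem length_eraseEach (x : α) (l : List α) : (eraseEach x l).length = l.count x := by
  induction l with
  | nil => simp [eraseEach]
  | cons z l ih =>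
    rw [eraseEach, length_append, length_map, ih, count_cons]
    split_ifs <;> simp_all [add_comm]

theorem count_map_cons (z y : α) (r : List α) (E : List (List α)) :
    count (y :: r) (E.map (cons z)) = if z = y then count r E else 0 := by
  induction E with
  | nil => simp
  | cons e E ih =>
    rw [map_cons, count_cons, ih, count_cons]
    by_cases hz : z = y <;> simp [hz]

/-- Inserting `x` into `r` at some position yields `l` exactly when deleting `x` from that position
of `l` yields `r`. -/
theorem count_permutations'Aux (x : α) (l r : List α) :
    count l (permutations'Aux x r) = count r (eraseEach x l) := by
  induction r generalizing l with
  | nil =>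
    rcases l with _ | ⟨z, _ | ⟨z', l⟩⟩
    · simp [eraseEach]
    · rw [permutations'Aux, count_singleton, eraseEach]
      by_cases h : z = x
      · simp [h, eraseEach]
      · simp [h, eraseEach, Ne.symm h]
    · have : ([] : List α) ∉ eraseEach x (z :: z' :: l) := fun h => by
        simpa using (cons_perm_of_mem_eraseEach h).length_eq
      rw [count_eq_zero_of_not_mem this]
      simp
  | cons y r ih =>
    rcases l with _ | ⟨z, l⟩
    · simp [eraseEach, count_eq_zero]
    · rw [permutations'Aux, count_cons, count_map_cons, eraseEach, count_append, count_map_cons, ih]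
      by_cases h : z = x
      · subst h; by_cases h' : l = y :: r
        · subst h'
          simp [add_comm, eq_comm (a := y) (b := z)]
        · simp [Ne.symm h', h', eq_comm (a := y) (b := z)]
      · simp [h, Ne.symm h, eq_comm (a := y) (b := z)]

/-- Both sides count the pairs of equal entries, one from `S` and one from `E`. -/
theorem sum_map_count_comm {β : Type*} [BEq β] [LawfulBEq β] (S E : List β) :
    (S.map fun r => count r E).sum = (E.map fun e => count e S).sum := by
  induction E with
  | nil => simp
  | cons e E ih =>
    simp only [count_cons, sum_map_add, map_cons, sum_cons, ih]
    rw [add_comm]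
    congr 1
    clear ih
    induction S with
    | nil => simp
    | cons a S ih =>
      rw [map_cons, sum_cons, ih, count_cons, add_comm]
      by_cases h : a = e
      · simp [h]
      · simp [beq_eq_false_iff_ne.2 h, beq_eq_false_iff_ne.2 (Ne.symm h)]

/-- Orderings of a multiset with repeated elements are listed with multiplicity, so the uniform
ordering is exchangeable only once these multiplicities agree. Splitting off the first element `x`
of `l₀` multiplies the count by the number of `x` in `l` and erases one of them, and both operations
respect permutations of `l`. -/
theorem count_permutations_of_perm {l l' : List α} (h : l.Perm l') (l₀ : List α) :
    count l l₀.permutations = count l' l₀.permutations := by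
  rw [(permutations_perm_permutations' l₀).count_eq, (permutations_perm_permutations' l₀).count_eq]
  induction l₀ generalizing l l' with
  | nil =>
    rcases l with _ | ⟨z, l⟩
    · rw [h.nil_eq]
    · rcases l' with _ | ⟨z', l'⟩
      · simpa using h.length_eq
      · simp
  | cons x l₀ ih =>
    have key : ∀ l : List α, (∀ e ∈ eraseEach x l,
        count e (permutations' l₀) = count (l.erase x) (permutations' l₀)) →
        count l (permutations' (x :: l₀)) = l.count x * count (l.erase x) (permutations' l₀) := by
      intro l hl
      rw [permutations', count_flatMap]
      have : (count l ∘ permutations'Aux x) = fun r => count r (eraseEach x l) := by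
        ext r; exact count_permutations'Aux x l r
      rw [this, sum_map_count_comm, map_congr_left hl, map_const', sum_replicate, length_eraseEach,
        smul_eq_mul]
    have hE : ∀ l : List α, ∀ e ∈ eraseEach x l,
        count e (permutations' l₀) = count (l.erase x) (permutations' l₀) := by
      intro l e he
      refine ih ?_
      simpa using (cons_perm_of_mem_eraseEach he).erase x
    rw [key l (hE l), key l' (hE l'), h.count_eq x, ih (h.erase x)]

end ListOrderings

/-! ### Sums over lists, and resampling of the entries of a list -/

theorem ENNReal.tsum_list {α : Type*} (g : List α → ℝ≥0∞) :
    ∑' l, g l = g [] + ∑' a, ∑' l, g (a :: l) := by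
  classical
  rw [ENNReal.tsum_eq_add_tsum_ite []]
  congr 1
  rw [← ENNReal.tsum_prod (f := fun a l => g (a :: l))]
  have hinj : Function.Injective fun p : α × List α => p.1 :: p.2 := by
    rintro ⟨a, l⟩ ⟨b, l'⟩ h
    simpa using h
  rw [← hinj.tsum_eq]
  · simp
  · intro l hl
    rcases l with _ | ⟨a, l⟩
    · simp at hl
    · exact ⟨(a, l), rfl⟩

namespace Resample

variable {α β : Type*} [Fintype α] [DecidableEq β] (s : α → β)

/-- The transition probabilities of the kernel that replaces an element `a` by a uniformly random
element of the fibre of `s` that contains `a`. -/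
def step (a b : α) : ℝ≥0∞ :=
  if s a = s b then ((Finset.univ.filter fun c => s c = s a).card : ℝ≥0∞)⁻¹ else 0

/-- The transition probabilities of the kernel that applies `step` to all entries of a list,
independently. -/
def kernel : List α → List α → ℝ≥0∞
  | [], [] => 1
  | a :: l, b :: l' => step s a b * kernel l l'
  | [], _ :: _ => 0
  | _ :: _, [] => 0

theorem step_comm (a b : α) : step s a b = step s b a := by
  by_cases h : s a = s b
  · simp [step, h]
  · simp [step, h, Ne.symm h]

theorem step_congr_right {a b b' : α} (h : s b = s b') : step s a b = step s a b' := by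
  simp [step, h]

theorem tsum_step_mul (a : α) (w : α → ℝ≥0∞) :
    ∑' b, step s a b * w b = (∑ b ∈ Finset.univ.filter fun c => s c = s a, w b) /
      ((Finset.univ.filter fun c => s c = s a).card : ℝ≥0∞) := by
  rw [tsum_fintype, Finset.sum_filter, ENNReal.div_eq_inv_mul, Finset.mul_sum]
  refine Finset.sum_congr rfl fun b _ => ?_
  by_cases h : s a = s b
  · simp [step, h]
  · simp [step, h, Ne.symm h]

theorem tsum_step (a : α) : ∑' b, step s a b = 1 := by
  have := tsum_step_mul s a fun _ => 1
  simp only [mul_one, Finset.sum_const, nsmul_eq_mul] at this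
  rw [this, ENNReal.div_self]
  · exact Nat.cast_ne_zero.2 (Finset.card_ne_zero_of_mem (a := a) (by simp))
  · exact ENNReal.natCast_ne_top _

theorem kernel_comm (l l' : List α) : kernel s l l' = kernel s l' l := by
  induction l generalizing l' with
  | nil => cases l' <;> simp [kernel]
  | cons a l ih => cases l' <;> simp [kernel, step_comm s a, ih]

theorem map_eq_of_kernel_ne_zero {l l' : List α} (h : kernel s l l' ≠ 0) : l.map s = l'.map s := by
  induction l generalizing l' with
  | nil => cases l' <;> simp_all [kernel]
  | cons a l ih =>
    cases l' with
    | nil => simp [kernel] at h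
    | cons b l' =>
      rw [kernel] at h
      have h2 := ih (right_ne_zero_of_mul h)
      have h1 : s a = s b := by
        by_contra hc
        simp [step, hc] at h
      simp [h1, h2]

theorem kernel_congr_right {l l' l'' : List α} (h : l'.map s = l''.map s) :
    kernel s l l' = kernel s l l'' := by
  induction l generalizing l' l'' with
  | nil => cases l' <;> cases l'' <;> simp_all [kernel]
  | cons a l ih =>
    rcases l' with _ | ⟨b, l'⟩ <;> rcases l'' with _ | ⟨b', l''⟩
    · rfl
    · simp at h
    · simp at h
    · simp only [List.map_cons, List.cons.injEq] at h
      rw [kernel, kernel, step_congr_right s h.1, ih h.2]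

/-- The entries are resampled independently, so the expectation of the product factorizes. -/
theorem tsum_kernel_mul (w : α → ℝ≥0∞) (l : List α) :
    ∑' l', kernel s l l' * (l'.map w).prod = (l.map fun a => ∑' b, step s a b * w b).prod := by
  induction l with
  | nil => rw [ENNReal.tsum_list]; simp [kernel]
  | cons a l ih =>
    rw [ENNReal.tsum_list]
    simp only [kernel, zero_mul, zero_add, List.map_cons, List.prod_cons]
    rw [← ih, ← ENNReal.tsum_mul_right]
    refine tsum_congr fun b => ?_
    rw [← ENNReal.tsum_mul_left]
    exact tsum_congr fun l' => by ring

theorem tsum_kernel (l : List α) : ∑' l', kernel s l l' = 1 := by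
  have := tsum_kernel_mul s (fun _ => 1) l
  simp_rw [mul_one, tsum_step] at this
  simpa using this

/-- If a function of lists depends only on the images of the entries, then it is invariant under
resampling. -/
theorem tsum_mul_prod_resample {f : List α → ℝ≥0∞}
    (hf : ∀ l l', l.map s = l'.map s → f l = f l') (w : α → ℝ≥0∞) :
    ∑' l, f l * (l.map fun a => ∑' b, step s a b * w b).prod = ∑' l, f l * (l.map w).prod := by
  simp_rw [← tsum_kernel_mul s w, ← ENNReal.tsum_mul_left]
  rw [ENNReal.tsum_comm]
  refine tsum_congr fun l' => ?_
  -- Reversibility: the kernel is symmetric and only joins lists on which `f` takes the same value.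
  have : ∀ l, f l * (kernel s l l' * (l'.map w).prod) = kernel s l' l * (f l' * (l'.map w).prod) := by
    intro l
    rw [kernel_comm s l l']
    by_cases h : kernel s l' l = 0
    · simp [h]
    · rw [hf l l' (map_eq_of_kernel_ne_zero s h).symm]; ring
  simp_rw [this]
  rw [ENNReal.tsum_mul_right, tsum_kernel, one_mul]

/-- The image of a function of lists under resampling of the entries. -/
def apply (f : List α → ℝ≥0∞) (l' : List α) : ℝ≥0∞ := ∑' l, f l * kernel s l l'

theorem apply_congr (f : List α → ℝ≥0∞) {l l' : List α} (h : l.map s = l'.map s) :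
    apply s f l = apply s f l' :=
  tsum_congr fun l₀ => by rw [kernel_congr_right s h]

theorem tsum_apply_mul (f : List α → ℝ≥0∞) (w : α → ℝ≥0∞) :
    ∑' l, apply s f l * (l.map w).prod =
      ∑' l, f l * (l.map fun a => ∑' b, step s a b * w b).prod := by
  simp_rw [← tsum_kernel_mul s w, ← ENNReal.tsum_mul_left, apply, ← ENNReal.tsum_mul_right]
  rw [ENNReal.tsum_comm]
  exact tsum_congr fun l => tsum_congr fun l' => by ring

theorem apply_cons (f : List α → ℝ≥0∞) (b : α) (l : List α) :
    apply s f (b :: l) = ∑' a, step s a b * apply s (fun l₀ => f (a :: l₀)) l := by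
  rw [apply, ENNReal.tsum_list]
  simp only [kernel, mul_zero, zero_add, apply, ← ENNReal.tsum_mul_left]
  exact tsum_congr fun a => tsum_congr fun l' => by ring

/-- All entries are resampled by the same rule, so resampling commutes with reordering; an adjacent
swap is an exchange of two sums. -/
theorem apply_perm {f : List α → ℝ≥0∞} (hf : ∀ l l', l.Perm l' → f l = f l') {l l' : List α}
    (h : l.Perm l') : apply s f l = apply s f l' := by
  induction h generalizing f with
  | nil => rfl
  | cons b _ ih =>
    simp_rw [apply_cons]
    refine tsum_congr fun a => ?_
    rw [ih fun l l' hl => hf _ _ (hl.cons a)]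
  | swap b b' l =>
    simp_rw [apply_cons, ← ENNReal.tsum_mul_left]
    rw [ENNReal.tsum_comm]
    refine tsum_congr fun a => tsum_congr fun a' => ?_
    rw [show (fun l₀ => f (a' :: a :: l₀)) = fun l₀ => f (a :: a' :: l₀) from
      funext fun l₀ => hf _ _ (List.Perm.swap a a' l₀)]
    ring
  | trans _ _ ih ih' => exact (ih hf).trans (ih' hf)

end Resample

/-! ### EFPF as invariance of the generating functional under size averaging -/

namespace FeatureAllocation

variable {N : ℕ}

theorem randomOrdering_congr (F : FeatureAllocation N) {l l' : List (Finset (Fin N))}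
    (h : l.Perm l') : F.randomOrdering l = F.randomOrdering l' := by
  classical
  obtain ⟨l₀, hl₀⟩ := Quotient.exists_rep F.features
  have hl₀' : F.features.lists = (l₀.permutations : Multiset (List (Finset (Fin N)))) := by
    rw [← hl₀]; rfl
  simp only [randomOrdering, PMF.ofMultiset_apply]
  congr 2
  rw [hl₀']
  simp only [Multiset.coe_count]
  convert ListOrderings.count_permutations_of_perm h l₀ using 2 <;>
    exact lawful_beq_subsingleton _ _

theorem coe_eq_of_randomOrdering_ne_zero {F : FeatureAllocation N} {l : List (Finset (Fin N))}
    (h : F.randomOrdering l ≠ 0) : (l : Multiset (Finset (Fin N))) = F.features := by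
  by_contra hc
  refine h (PMF.ofMultiset_apply_of_notMem _ fun hl => hc ?_)
  exact ((Multiset.mem_lists_iff _ _).1 hl).symm

/-- The law of the uniformly ordered list of features of a random feature allocation of `[N]` with
law `ν`. -/
def listProb (ν : Measure (FeatureAllocation N)) (l : List (Finset (Fin N))) : ℝ≥0∞ :=
  ∫⁻ F, F.randomOrdering l ∂ν

theorem listProb_perm (ν : Measure (FeatureAllocation N)) {l l' : List (Finset (Fin N))}
    (h : l.Perm l') : listProb ν l = listProb ν l' :=
  lintegral_congr fun F => F.randomOrdering_congr h

theorem listProb_eq_zero (ν : Measure (FeatureAllocation N)) {l : List (Finset (Fin N))}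
    (h : ¬ ∀ A ∈ l, A.Nonempty) : listProb ν l = 0 := by
  rw [listProb, lintegral_eq_zero_iff .of_discrete]
  refine ae_of_all _ fun F => ?_
  by_contra hc
  refine h fun A hA => F.nonempty A ?_
  rw [← coe_eq_of_randomOrdering_ne_zero hc]
  exact hA

/-- The product does not see the order of the features, so summing over the orderings of each `F`
leaves the generating functional. -/
theorem tsum_listProb_mul (ν : Measure (FeatureAllocation N)) (w : Finset (Fin N) → ℝ≥0∞) :
    ∑' l, listProb ν l * (l.map w).prod = ∫⁻ F, (F.features.map w).prod ∂ν := by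
  simp_rw [listProb, ← lintegral_mul_const _ (Measurable.of_discrete (f := fun F =>
    FeatureAllocation.randomOrdering F _))]
  rw [← lintegral_tsum fun l => Measurable.of_discrete.aemeasurable]
  refine lintegral_congr fun F => ?_
  have : ∀ l, F.randomOrdering l * (l.map w).prod =
      F.randomOrdering l * (F.features.map w).prod := by
    intro l
    by_cases h : F.randomOrdering l = 0
    · simp [h]
    · rw [← coe_eq_of_randomOrdering_ne_zero h]; simp
  simp_rw [this]
  rw [ENNReal.tsum_mul_right, PMF.tsum_coe, one_mul]

/-- The average of `t` over the sets of the same size. -/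
def sizeAverage (t : Finset (Fin N) → ℝ) (A : Finset (Fin N)) : ℝ :=
  (∑ B ∈ Finset.univ.filter fun B : Finset (Fin N) => B.card = A.card, t B) /
    (Finset.univ.filter fun B : Finset (Fin N) => B.card = A.card).card

theorem card_filter_card_pos (A : Finset (Fin N)) :
    0 < (Finset.univ.filter fun B : Finset (Fin N) => B.card = A.card).card :=
  Finset.card_pos.2 ⟨A, by simp⟩

theorem IsWeight.sizeAverage {t : Finset (Fin N) → ℝ} (h : IsWeight t) : IsWeight (sizeAverage t) where
  empty := by
    simp [FeatureAllocation.sizeAverage, Finset.filter_eq', h.empty]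
  pos A := div_pos (Finset.sum_pos (fun B _ => h.pos B) ⟨A, by simp⟩)
    (by exact_mod_cast card_filter_card_pos A)
  le_one A := by
    refine div_le_one_of_le₀ ?_ (by positivity)
    refine (Finset.sum_le_card_nsmul _ _ 1 fun B _ => h.le_one B).trans ?_
    simp

theorem IsTest.sizeAverage {t : Finset (Fin N) → ℝ} (h : IsTest t) : IsTest (sizeAverage t) where
  toIsWeight := h.toIsWeight.sizeAverage
  lt_one A hA := by
    rw [FeatureAllocation.sizeAverage, div_lt_one (by exact_mod_cast card_filter_card_pos A)]
    refine (Finset.sum_lt_sum_of_nonempty (g := fun _ => 1) ⟨A, by simp⟩ fun B hB => ?_).trans_le ?_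
    · refine h.lt_one B (Finset.card_pos.1 ?_)
      rw [(Finset.mem_filter.1 hB).2]
      exact hA.card_pos
    · simp

theorem ofReal_weight {t : Finset (Fin N) → ℝ} (h : ∀ A, 0 ≤ t A) (F : FeatureAllocation N) :
    ENNReal.ofReal (weight t F) = (F.features.map fun A => ENNReal.ofReal (t A)).prod := by
  unfold weight
  induction F.features using Multiset.induction with
  | empty => simp
  | cons A s ih =>
    rw [Multiset.map_cons, Multiset.prod_cons, Multiset.map_cons, Multiset.prod_cons,
      ENNReal.ofReal_mul (h A), ih]

theorem tsum_listProb_mul_ofReal {ν : Measure (FeatureAllocation N)} [IsFiniteMeasure ν]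
    {t : Finset (Fin N) → ℝ} (h : IsWeight t) :
    ∑' l, listProb ν l * (l.map fun A => ENNReal.ofReal (t A)).prod =
      ENNReal.ofReal (∫ F, weight t F ∂ν) := by
  rw [tsum_listProb_mul, ofReal_integral_eq_lintegral_ofReal (h.integrable_weight ν)
    (ae_of_all _ h.weight_nonneg)]
  exact lintegral_congr fun F => (ofReal_weight (fun A => (h.pos A).le) F).symm

theorem tsum_step_ofReal {t : Finset (Fin N) → ℝ} (h : IsWeight t) (A : Finset (Fin N)) :
    ∑' B, Resample.step Finset.card A B * ENNReal.ofReal (t B) =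
      ENNReal.ofReal (sizeAverage t A) := by
  rw [Resample.tsum_step_mul, sizeAverage, ENNReal.ofReal_div_of_pos
    (by exact_mod_cast card_filter_card_pos A), ENNReal.ofReal_natCast,
    ENNReal.ofReal_sum_of_nonneg fun B _ => (h.pos B).le]

/-- If the law of the uniformly ordered list of features depends only on the sizes of the features,
then the generating functional is invariant under averaging over sets of the same size. -/
theorem integral_weight_sizeAverage {ν : Measure (FeatureAllocation N)} [IsFiniteMeasure ν]
    (hν : ∀ l l' : List (Finset (Fin N)), l.map Finset.card = l'.map Finset.card →
      listProb ν l = listProb ν l')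
    {t : Finset (Fin N) → ℝ} (h : IsWeight t) :
    ∫ F, weight (sizeAverage t) F ∂ν = ∫ F, weight t F ∂ν := by
  rw [← ENNReal.ofReal_eq_ofReal_iff (integral_nonneg h.sizeAverage.weight_nonneg)
    (integral_nonneg h.weight_nonneg), ← tsum_listProb_mul_ofReal h.sizeAverage,
    ← tsum_listProb_mul_ofReal h,
    ← Resample.tsum_mul_prod_resample Finset.card hν fun A => ENNReal.ofReal (t A)]
  simp_rw [tsum_step_ofReal h]

/-- The feature allocation whose features are the non-empty sets in a list. -/
def ofList (l : List (Finset (Fin N))) : FeatureAllocation N where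
  features := (l : Multiset (Finset (Fin N))).filter Finset.Nonempty
  nonempty := fun _ hA => (Multiset.mem_filter.1 hA).2

theorem ofList_features {l : List (Finset (Fin N))} (h : ∀ A ∈ l, A.Nonempty) :
    (ofList l).features = (l : Multiset (Finset (Fin N))) := by
  simp only [ofList]
  exact Multiset.filter_eq_self.2 fun A hA => h A (by simpa using hA)

/-- If the generating functional is invariant under averaging over sets of the same size, then
the law of the uniformly ordered list of features depends only on the sizes of the features. -/
theorem listProb_congr_of_sizeAverage {ν : Measure (FeatureAllocation N)} [IsProbabilityMeasure ν]
    (hν : ∀ t, IsTest t → ∫ F, weight (sizeAverage t) F ∂ν = ∫ F, weight t F ∂ν)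
    {l l' : List (Finset (Fin N))} (hl : ∀ A ∈ l, A.Nonempty)
    (hll' : l.map Finset.card = l'.map Finset.card) : listProb ν l = listProb ν l' := by
  classical
  -- Resampling each set uniformly among those of its size gives a list function that depends on
  -- sizes only; the goal is to show that on lists of non-empty sets it coincides with `listProb ν`.
  set f' : List (Finset (Fin N)) → ℝ≥0∞ := Resample.apply Finset.card (listProb ν) with hf'
  have hzero : ∀ l, (¬ ∀ A ∈ l, A.Nonempty) → f' l = 0 := by
    intro l hl
    rw [hf', Resample.apply, ENNReal.tsum_eq_zero]
    intro l₀
    by_cases hk : Resample.kernel Finset.card l₀ l = 0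
    · simp [hk]
    · rw [listProb_eq_zero ν, zero_mul]
      intro hl₀
      refine hl fun A hA => ?_
      have hA' : A.card ∈ l.map Finset.card := List.mem_map_of_mem hA
      rw [← Resample.map_eq_of_kernel_ne_zero _ hk] at hA'
      obtain ⟨B, hB, hBA⟩ := List.mem_map.1 hA'
      rw [← Finset.card_pos, ← hBA]
      exact (hl₀ B hB).card_pos
  have hf'perm : ∀ l l', l.Perm l' → f' l = f' l' := fun _ _ h =>
    Resample.apply_perm _ (fun _ _ => listProb_perm ν) h
  let ν' : Measure (FeatureAllocation N) := Measure.sum fun l => f' l • Measure.dirac (ofList l)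
  have hint : ∀ g : FeatureAllocation N → ℝ≥0∞, ∫⁻ F, g F ∂ν' = ∑' l, f' l * g (ofList l) := by
    intro g
    rw [lintegral_sum_measure]
    refine tsum_congr fun l => ?_
    rw [lintegral_smul_measure, lintegral_dirac' _ .of_discrete, smul_eq_mul]
  have hw : ∀ w : Finset (Fin N) → ℝ≥0∞, ∫⁻ F, (F.features.map w).prod ∂ν' =
      ∑' l, f' l * (l.map w).prod := by
    intro w
    rw [hint]
    refine tsum_congr fun l => ?_
    by_cases hl : ∀ A ∈ l, A.Nonempty
    · rw [ofList_features hl]; simp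
    · rw [hzero l hl]; simp
  have hprob : IsProbabilityMeasure ν' := by
    constructor
    have h1 := hw fun _ => 1
    have h2 := tsum_listProb_mul ν fun _ => 1
    rw [Resample.tsum_apply_mul] at h1
    simp only [mul_one, Resample.tsum_step] at h1
    rw [h2] at h1
    simpa using h1
  -- The functional of `ν'` at `t` is that of `ν` at `sizeAverage t`, which by hypothesis is that of
  -- `ν` at `t`.
  have heq : ν' = ν := by
    refine measure_ext_of_weight fun t ht => ?_
    rw [← hν t ht, ← ENNReal.ofReal_eq_ofReal_iff (integral_nonneg ht.weight_nonneg)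
      (integral_nonneg ht.sizeAverage.weight_nonneg), ← tsum_listProb_mul_ofReal ht.sizeAverage.toIsWeight,
      ofReal_integral_eq_lintegral_ofReal (ht.integrable_weight ν')
      (ae_of_all _ ht.weight_nonneg)]
    simp_rw [ofReal_weight fun A => (ht.pos A).le]
    rw [hw, hf', Resample.tsum_apply_mul]
    simp_rw [tsum_step_ofReal ht.toIsWeight]
  -- Equality of laws only compares unordered features. As `listProb ν` and `f'` are both
  -- permutation invariant, each spreads the mass of `{ofList l}` evenly over the distinct orderings
  -- of `l`; `hone` says that one ordering has the reciprocal of their number as its probability.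
  have key : ∀ l : List (Finset (Fin N)), (∀ A ∈ l, A.Nonempty) → listProb ν l = f' l := by
    intro l hl
    have hperm : ∀ l', ofList l' = ofList l → f' l' ≠ 0 → l'.Perm l := by
      intro l' h1 h2
      have h3 : ∀ A ∈ l', A.Nonempty := by
        by_contra hc
        exact h2 (hzero l' hc)
      rw [← Multiset.coe_eq_coe, ← ofList_features h3, h1, ofList_features hl]
    have hone : (ofList l).randomOrdering l * ∑' l' : List (Finset (Fin N)),
        (if l'.Perm l then 1 else 0 : ℝ≥0∞) = 1 := by
      refine Eq.trans ?_ (ofList l).randomOrdering.tsum_coe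
      rw [← ENNReal.tsum_mul_left]
      refine tsum_congr fun l' => ?_
      split_ifs with h
      · rw [mul_one]; exact (randomOrdering_congr _ h).symm
      · rw [mul_zero]
        by_contra hc
        refine h (Multiset.coe_eq_coe.1 ?_)
        rw [coe_eq_of_randomOrdering_ne_zero (Ne.symm hc), ofList_features hl]
    have h1 : listProb ν l = ν {ofList l} * (ofList l).randomOrdering l := by
      have : ∀ F : FeatureAllocation N, F.randomOrdering l =
          (ofList l).randomOrdering l * Set.indicator {ofList l} 1 F := by
        intro F
        by_cases hF : F = ofList l
        · simp [hF]
        · rw [Set.indicator_of_notMem (by simpa using hF), mul_zero]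
          by_contra hc
          refine hF (FeatureAllocation.ext ?_)
          rw [ofList_features hl, coe_eq_of_randomOrdering_ne_zero hc]
      rw [listProb, lintegral_congr this, lintegral_const_mul _ .of_discrete,
        lintegral_indicator_one .of_discrete, mul_comm]
    have h2 : ν {ofList l} = f' l * ∑' l' : List (Finset (Fin N)),
        (if l'.Perm l then 1 else 0 : ℝ≥0∞) := by
      rw [← heq, ← lintegral_indicator_one .of_discrete, hint, ← ENNReal.tsum_mul_left]
      refine tsum_congr fun l' => ?_
      by_cases h0 : f' l' = 0
      · split_ifs with h
        · rw [← hf'perm _ _ h, h0]; simp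
        · simp [h0]
      · by_cases h : l'.Perm l
        · have : ofList l' = ofList l := by
            refine FeatureAllocation.ext ?_
            simp only [ofList]
            rw [Multiset.coe_eq_coe.2 h]
          rw [if_pos h, this, hf'perm _ _ h]
          simp
        · rw [if_neg h, Set.indicator_of_notMem]
          · simp
          · exact fun hc => h (hperm l' hc h0)
    rw [h1, h2, mul_assoc, mul_comm (∑' l', _), hone, mul_one]
  have hl' : ∀ A ∈ l', A.Nonempty := by
    intro A hA
    have hA' : A.card ∈ l'.map Finset.card := List.mem_map_of_mem hA
    rw [← hll'] at hA'
    obtain ⟨B, hB, hBA⟩ := List.mem_map.1 hA'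
    rw [← Finset.card_pos, ← hBA]
    exact (hl B hB).card_pos
  rw [key l hl, key l' hl', hf', Resample.apply_congr _ _ hll']

end FeatureAllocation

namespace FeatureAllocationSeq

open FeatureAllocation

theorem orderedProb_eq (μ : Measure FeatureAllocationSeq) (N : ℕ) (l : List (Finset (Fin N))) :
    orderedProb μ N l = listProb (μ.map fun F => F.level N) l := by
  rw [listProb, lintegral_map .of_discrete (measurable_level N), orderedProb]

instance (μ : Measure FeatureAllocationSeq) [IsProbabilityMeasure μ] (N : ℕ) :
    IsProbabilityMeasure (μ.map fun F => F.level N) :=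
  Measure.isProbabilityMeasure_map (measurable_level N).aemeasurable

theorem HasEFPF.integral_weight_sizeAverage {μ : Measure FeatureAllocationSeq}
    [IsProbabilityMeasure μ] (h : HasEFPF μ) {N : ℕ} {t : Finset (Fin N) → ℝ} (ht : IsWeight t) :
    ∫ F, weight (sizeAverage t) F ∂(μ.map fun F => F.level N) =
      ∫ F, weight t F ∂(μ.map fun F => F.level N) := by
  obtain ⟨p, -, hp⟩ := h
  have hne : ∀ l l' : List (Finset (Fin N)), l.map Finset.card = l'.map Finset.card →
      (∀ A ∈ l, A.Nonempty) → ∀ A ∈ l', A.Nonempty := by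
    intro l l' hll' hl A hA
    have hA' : A.card ∈ l'.map Finset.card := List.mem_map_of_mem hA
    rw [← hll'] at hA'
    obtain ⟨B, hB, hBA⟩ := List.mem_map.1 hA'
    rw [← Finset.card_pos, ← hBA]
    exact (hl B hB).card_pos
  refine FeatureAllocation.integral_weight_sizeAverage (fun l l' hll' => ?_) ht
  by_cases hl : ∀ A ∈ l, A.Nonempty
  · rw [← orderedProb_eq, ← orderedProb_eq, hp N l hl, hp N l' (hne l l' hll' hl), hll']
  · rw [listProb_eq_zero _ hl, listProb_eq_zero _ fun h => hl (hne l' l hll'.symm h)]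

theorem hasEFPF_of_sizeAverage {μ : Measure FeatureAllocationSeq} [IsProbabilityMeasure μ]
    (h : ∀ N, ∀ t : Finset (Fin N) → ℝ, IsTest t →
      ∫ F, weight (sizeAverage t) F ∂(μ.map fun F => F.level N) =
        ∫ F, weight t F ∂(μ.map fun F => F.level N)) : HasEFPF μ := by
  classical
  let P : ∀ (N : ℕ) (m : List ℕ), List (Finset (Fin N)) → Prop := fun N m l =>
    (∀ A ∈ l, A.Nonempty) ∧ (l.map Finset.card).Perm m
  have key : ∀ N (l l' : List (Finset (Fin N))), (∀ A ∈ l, A.Nonempty) →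
      (l.map Finset.card).Perm (l'.map Finset.card) → orderedProb μ N l = orderedProb μ N l' := by
    intro N l l' hl hll'
    -- Reordering `l` makes its list of sizes equal to that of `l'`, not just a permutation of it.
    obtain ⟨l₁, h1, h2⟩ : ∃ l₁, l.Perm l₁ ∧ l₁.map Finset.card = l'.map Finset.card := by
      have h0 : List.Forall₂ (fun (a : ℕ) (A : Finset (Fin N)) => a = A.card)
          (l.map Finset.card) l := by
        rw [List.forall₂_map_left_iff]
        exact List.forall₂_same.2 fun _ _ => rfl
      obtain ⟨l₁, hl₁, hp⟩ := List.perm_comp_forall₂ hll'.symm h0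
      refine ⟨l₁, hp.symm, ?_⟩
      clear hp h0 hll' hl
      generalize l'.map Finset.card = m at hl₁
      induction hl₁ with
      | nil => rfl
      | cons h _ ih => simp [h, ih]
    rw [orderedProb_eq, orderedProb_eq, listProb_perm _ h1]
    exact listProb_congr_of_sizeAverage (h N) (fun A hA => hl A (h1.mem_iff.2 hA)) h2
  -- `P` tests sizes only up to permutation, so permuted arguments select the same list and `p` is
  -- symmetric; size lists realized by no features get the value `0`.
  refine ⟨fun N m => if hm : ∃ l, P N m l then orderedProb μ N hm.choose else 0, ?_, ?_⟩
  · intro N m m' hmm'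
    have : P N m = P N m' := by
      ext l
      exact and_congr_right fun _ => ⟨fun h => h.trans hmm', fun h => h.trans hmm'.symm⟩
    simp only [this]
  · intro N l hl
    have hm : ∃ l', P N (l.map Finset.card) l' := ⟨l, hl, List.Perm.refl _⟩
    simp only [dif_pos hm]
    exact key N l _ hl hm.choose_spec.2.symm

end FeatureAllocationSeq

/-! ### The one-feature functional `bern t` and its logarithm -/

namespace FeatureAllocation

variable {M : ℕ}

/-- The expected value of `t A` if `A` is a subset of `[M]` to which the elements belong
independently with probability `v`. -/
def bern (t : Finset (Fin M) → ℝ) (v : ℝ) : ℝ :=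
  ∑ B : Finset (Fin M), t B * (v ^ B.card * (1 - v) ^ (M - B.card))

/-- The sum of `1 - t {i}` over `i ∈ [M]`. -/
def singletonDefect (t : Finset (Fin M) → ℝ) : ℝ := ∑ i, (1 - t {i})

variable {t : Finset (Fin M) → ℝ} {v : ℝ}

theorem bernTerm_nonneg (h0 : 0 ≤ v) (h1 : v ≤ 1) (B : Finset (Fin M)) :
    0 ≤ v ^ B.card * (1 - v) ^ (M - B.card) :=
  mul_nonneg (pow_nonneg h0 _) (pow_nonneg (by linarith) _)

theorem sum_bernTerm (v : ℝ) : ∑ B : Finset (Fin M), v ^ B.card * (1 - v) ^ (M - B.card) = 1 := by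
  rw [Fin.sum_pow_mul_eq_add_pow]; simp

theorem continuous_bern (t : Finset (Fin M) → ℝ) : Continuous (bern t) := by
  unfold bern; fun_prop

theorem bern_zero (ht : t ∅ = 1) : bern t 0 = 1 := by
  rw [bern, Finset.sum_eq_single ∅]
  · simp [ht]
  · intro B _ hB
    simp [Finset.card_ne_zero.2 (Finset.nonempty_iff_ne_empty.2 hB)]
  · simp

theorem le_bern {δ : ℝ} (ht : ∀ B, δ ≤ t B) (h0 : 0 ≤ v) (h1 : v ≤ 1) : δ ≤ bern t v := by
  rw [← mul_one δ, ← sum_bernTerm (M := M) v, Finset.mul_sum]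
  exact Finset.sum_le_sum fun B _ => mul_le_mul_of_nonneg_right (ht B) (bernTerm_nonneg h0 h1 B)

/-- A Bernoulli set is non-empty with probability `1 - (1 - v) ^ M`, which is at least `v` because
`M ≠ 0`. -/
theorem bern_le {τ : ℝ} (hM : M ≠ 0) (hτ : τ ≤ 1) (ht0 : t ∅ = 1) (ht : ∀ B, B.Nonempty → t B ≤ τ)
    (h0 : 0 ≤ v) (h1 : v ≤ 1) : bern t v ≤ 1 - (1 - τ) * v := by
  have key : bern t v ≤ ∑ B : Finset (Fin M), (τ * (v ^ B.card * (1 - v) ^ (M - B.card)) +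
      if B = ∅ then (1 - τ) * (1 - v) ^ M else 0) := by
    refine Finset.sum_le_sum fun B _ => ?_
    split_ifs with hB
    · subst hB
      simp only [ht0, Finset.card_empty, pow_zero, tsub_zero]
      linarith
    · rw [add_zero]
      exact mul_le_mul_of_nonneg_right (ht B (Finset.nonempty_iff_ne_empty.2 hB))
        (bernTerm_nonneg h0 h1 B)
  rw [Finset.sum_add_distrib, ← Finset.mul_sum, sum_bernTerm, Finset.sum_ite_eq' Finset.univ ∅,
    if_pos (Finset.mem_univ _)] at key
  have h2 : (1 - v) ^ M ≤ 1 - v := pow_le_of_le_one (by linarith) (by linarith) hM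
  nlinarith [mul_le_mul_of_nonneg_left h2 (sub_nonneg.2 hτ)]

theorem one_sub_pow_le (h0 : 0 ≤ v) (h1 : v ≤ 1) (n : ℕ) :
    (1 - v) ^ n ≤ 1 - n * v + n ^ 2 * v ^ 2 := by
  induction n with
  | zero => simp
  | succ n ih =>
    have h2 : (1 - v) ^ n ≤ 1 := pow_le_one₀ (by linarith) (by linarith)
    have h3 := one_add_mul_le_pow (a := -v) (by linarith) n
    rw [pow_succ]
    push_cast
    have h4 : (1 - v) ^ n * v ≥ (1 - n * v) * v :=
      mul_le_mul_of_nonneg_right (by rw [sub_eq_add_neg 1 v]; linarith) h0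
    nlinarith [sq_nonneg v, mul_nonneg (Nat.cast_nonneg (α := ℝ) n) (sq_nonneg v)]

/-- To first order in `v` only the empty set, with probability `1 - M v`, and the singletons, with
probability `v` each, occur. -/
theorem abs_bernTerm_sub_le (h0 : 0 ≤ v) (h1 : v ≤ 1) (B : Finset (Fin M)) :
    |v ^ B.card * (1 - v) ^ (M - B.card) -
      ((if B = ∅ then 1 - M * v else 0) + ∑ i, if B = {i} then v else 0)| ≤
      (M ^ 2 + 1) * v ^ 2 := by
  have hle : ∀ n : ℕ, (1 - v) ^ n ≤ 1 := fun n => pow_le_one₀ (by linarith) (by linarith)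
  have hb : ∀ n : ℕ, 1 - n * v ≤ (1 - v) ^ n := fun n => by
    have := one_add_mul_le_pow (a := -v) (by linarith) n
    rw [sub_eq_add_neg 1 v]; linarith
  have hM0 : (0 : ℝ) ≤ M := Nat.cast_nonneg M
  rcases Nat.lt_trichotomy B.card 1 with h | h | h
  · have hB : B = ∅ := Finset.card_eq_zero.1 (by omega)
    subst hB
    have hs : ∀ i : Fin M, (∅ : Finset (Fin M)) ≠ {i} := fun i =>
      (Finset.singleton_ne_empty i).symm
    simp only [Finset.card_empty, pow_zero, one_mul, tsub_zero, if_true, hs, if_false,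
      Finset.sum_const_zero, add_zero]
    rw [abs_le]
    constructor
    · nlinarith [hb M, sq_nonneg v, mul_nonneg (sq_nonneg (M : ℝ)) (sq_nonneg v)]
    · nlinarith [one_sub_pow_le h0 h1 M, sq_nonneg v]
  · obtain ⟨i, rfl⟩ := Finset.card_eq_one.1 h
    have hs : ∀ j : Fin M, (({i} : Finset (Fin M)) = {j}) = (i = j) := fun j => by
      rw [Finset.singleton_inj]
    simp only [Finset.card_singleton, pow_one, if_neg (Finset.singleton_ne_empty i), zero_add, hs,
      Finset.sum_ite_eq, Finset.mem_univ, if_true]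
    have hle' : (((M - 1 : ℕ) : ℝ)) ≤ M := by exact_mod_cast Nat.sub_le M 1
    have h3 := hb (M - 1)
    have h4 := hle (M - 1)
    have h5 : 1 - M * v ≤ (1 - v) ^ (M - 1) := by nlinarith
    have hMM : (M : ℝ) ≤ M ^ 2 + 1 := by nlinarith
    rw [abs_le]
    constructor
    · nlinarith [mul_le_mul_of_nonneg_left h5 h0, mul_le_mul_of_nonneg_right hMM (sq_nonneg v)]
    · nlinarith [mul_le_mul_of_nonneg_left h4 h0, mul_nonneg (add_nonneg (sq_nonneg (M : ℝ))
        zero_le_one) (sq_nonneg v)]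
  · have hB : B ≠ ∅ := by rintro rfl; simp at h
    have hs : ∀ i : Fin M, B ≠ {i} := by rintro i rfl; simp at h
    simp only [if_neg hB, hs, if_false, Finset.sum_const_zero, add_zero, sub_zero]
    rw [abs_of_nonneg (bernTerm_nonneg h0 h1 B)]
    have h2 : v ^ B.card ≤ v ^ 2 := pow_le_pow_of_le_one h0 h1 h
    calc v ^ B.card * (1 - v) ^ (M - B.card) ≤ v ^ 2 * 1 :=
          mul_le_mul h2 (hle _) (pow_nonneg (by linarith) _) (sq_nonneg v)
      _ ≤ (M ^ 2 + 1) * v ^ 2 := by nlinarith [mul_nonneg (sq_nonneg (M : ℝ)) (sq_nonneg v)]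

/-- The first-order expansion of `bern t` at `0`. -/
theorem exists_abs_bern_sub_le (h : IsTest t) : ∃ C, 0 ≤ C ∧ ∀ v, 0 ≤ v → v ≤ 1 →
    |bern t v - (1 - singletonDefect t * v)| ≤ C * v ^ 2 := by
  refine ⟨∑ B : Finset (Fin M), ((M : ℝ) ^ 2 + 1), by positivity, fun v h0 h1 => ?_⟩
  have hlin : 1 - singletonDefect t * v = ∑ B : Finset (Fin M), t B *
      ((if B = ∅ then 1 - M * v else 0) + ∑ i, if B = {i} then v else 0) := by
    simp only [mul_add, Finset.sum_add_distrib, Finset.mul_sum, mul_ite, mul_zero]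
    rw [Finset.sum_comm]
    simp only [Finset.sum_ite_eq', Finset.mem_univ, if_true, h.empty, one_mul, singletonDefect,
      Finset.sum_sub_distrib, Finset.sum_const, Finset.card_univ, Fintype.card_fin, nsmul_eq_mul,
      mul_one, ← Finset.sum_mul]
    ring
  rw [hlin, bern, ← Finset.sum_sub_distrib, Finset.sum_mul]
  refine (Finset.abs_sum_le_sum_abs _ _).trans (Finset.sum_le_sum fun B _ => ?_)
  rw [← mul_sub, abs_mul, abs_of_pos (h.pos B)]
  exact (mul_le_of_le_one_left (abs_nonneg _) (h.le_one B)).trans (abs_bernTerm_sub_le h0 h1 B)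

theorem IsTest.exists_lower_bound (h : IsTest t) : ∃ δ, 0 < δ ∧ ∀ B, δ ≤ t B := by
  obtain ⟨B, hB⟩ := Finite.exists_min t
  exact ⟨t B, h.pos B, hB⟩

theorem IsTest.exists_upper_bound (h : IsTest t) :
    ∃ τ, 0 ≤ τ ∧ τ < 1 ∧ ∀ B, B.Nonempty → t B ≤ τ := by
  obtain ⟨B, hB⟩ := Finite.exists_max fun B : Finset (Fin M) => if B.Nonempty then t B else 0
  refine ⟨if B.Nonempty then t B else 0, ?_, ?_, fun A hA => ?_⟩
  · split_ifs
    · exact (h.pos B).le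
    · exact le_rfl
  · split_ifs with hB'
    · exact h.lt_one B hB'
    · exact zero_lt_one
  · simpa [hA] using hB A

theorem IsTest.bern_pos (h : IsTest t) (h0 : 0 ≤ v) (h1 : v ≤ 1) : 0 < bern t v := by
  obtain ⟨δ, hδ, h⟩ := h.exists_lower_bound
  exact hδ.trans_le (le_bern h h0 h1)

theorem singletonDefect_nonneg (h : IsTest t) : 0 ≤ singletonDefect t :=
  Finset.sum_nonneg fun _ _ => sub_nonneg.2 (h.le_one _)

/-- The logarithm of `bern t`, with its linear part at `0` removed. -/
def logBern (t : Finset (Fin M) → ℝ) (v : ℝ) : ℝ := Real.log (bern t v) + singletonDefect t * v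

theorem logBern_zero (h : IsTest t) : logBern t 0 = 0 := by
  simp [logBern, bern_zero h.empty]

/-- Subtracting the linear part leaves a quadratic remainder, which is what makes the sum over
features continuous in the frequencies. For `x = bern t v` the bounds `1 - x⁻¹ ≤ log x ≤ x - 1`
differ by `(x - 1)² / x`; here `|x - 1| ≤ (a + C) v` and `x ≥ δ`, and `C v²` is the error in the
expansion of `x` itself. -/
theorem exists_abs_logBern_le (h : IsTest t) : ∃ C, 0 ≤ C ∧ ∀ v, 0 ≤ v → v ≤ 1 →
    |logBern t v| ≤ C * v ^ 2 := by
  obtain ⟨C, hC, hCb⟩ := exists_abs_bern_sub_le h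
  obtain ⟨δ, hδ, hδb⟩ := h.exists_lower_bound
  have ha := singletonDefect_nonneg h
  set a := singletonDefect t with ha'
  refine ⟨(a + C) ^ 2 / δ + C, by positivity, fun v h0 h1 => ?_⟩
  have hb := hCb v h0 h1
  have hpos := h.bern_pos h0 h1
  have hδv := le_bern hδb h0 h1
  have hv2 : v ^ 2 ≤ v := by nlinarith
  have hx : |bern t v - 1| ≤ (a + C) * v := by
    have : bern t v - 1 = (bern t v - (1 - a * v)) + -(a * v) := by ring
    rw [this]
    refine (abs_add_le _ _).trans ?_
    rw [abs_neg, abs_of_nonneg (mul_nonneg ha h0)]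
    nlinarith [mul_le_mul_of_nonneg_left hv2 hC]
  have hx2 : (bern t v - 1) ^ 2 ≤ ((a + C) * v) ^ 2 := by
    rw [← sq_abs]; exact pow_le_pow_left₀ (abs_nonneg _) hx 2
  have hl1 := Real.log_le_sub_one_of_pos hpos
  have hl2 := Real.one_sub_inv_le_log_of_pos hpos
  have hl3 : (bern t v - 1) - (1 - (bern t v)⁻¹) ≤ (a + C) ^ 2 / δ * v ^ 2 := by
    have : (bern t v - 1) - (1 - (bern t v)⁻¹) = (bern t v - 1) ^ 2 / bern t v := by
      field_simp
    rw [this, div_mul_eq_mul_div, ← mul_pow]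
    gcongr
  have := abs_le.1 hb
  rw [logBern, abs_le]
  constructor <;> nlinarith [sq_nonneg v, mul_nonneg (div_nonneg (sq_nonneg (a + C)) hδ.le)
    (sq_nonneg v)]

theorem bern_eq_exp (h : IsTest t) (h0 : 0 ≤ v) (h1 : v ≤ 1) :
    bern t v = Real.exp (logBern t v) * Real.exp (-(singletonDefect t * v)) := by
  rw [← Real.exp_add, logBern, add_neg_cancel_right, Real.exp_log (h.bern_pos h0 h1)]

theorem summable_logBern (h : IsTest t) {v : ℕ → unitInterval}
    (hv : Summable fun k => (v k : ℝ)) : Summable fun k => logBern t (v k) := by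
  obtain ⟨C, hC, hCb⟩ := exists_abs_logBern_le h
  refine Summable.of_norm_bounded (hv.mul_left C) fun k => ?_
  refine (hCb _ (v k).2.1 (v k).2.2).trans (mul_le_mul_of_nonneg_left ?_ hC)
  have := (v k).2
  nlinarith [this.1, this.2]

/-- The probability of a given set depends only on its size. -/
theorem bern_congr_size {t t' : Finset (Fin M) → ℝ}
    (h : ∀ m, ∑ B ∈ Finset.univ.filter fun B : Finset (Fin M) => B.card = m, t B =
      ∑ B ∈ Finset.univ.filter fun B : Finset (Fin M) => B.card = m, t' B) (v : ℝ) :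
    bern t v = bern t' v := by
  have key : ∀ t : Finset (Fin M) → ℝ, bern t v = ∑ m ∈ Finset.range (M + 1),
      (∑ B ∈ Finset.univ.filter fun B : Finset (Fin M) => B.card = m, t B) *
        (v ^ m * (1 - v) ^ (M - m)) := by
    intro t
    rw [bern, ← Finset.sum_fiberwise_of_maps_to (s := Finset.univ) (t := Finset.range (M + 1))
      (g := Finset.card)]
    · refine Finset.sum_congr rfl fun m _ => ?_
      rw [Finset.sum_mul]
      refine Finset.sum_congr rfl fun B hB => ?_
      rw [(Finset.mem_filter.1 hB).2]
    · intro B _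
      exact Finset.mem_range.2 (Nat.lt_succ_of_le (by simpa using Finset.card_le_univ B))
  rw [key t, key t']
  exact Finset.sum_congr rfl fun m _ => by rw [h]

theorem singletonDefect_congr_size {t t' : Finset (Fin M) → ℝ}
    (h : ∀ m, ∑ B ∈ Finset.univ.filter fun B : Finset (Fin M) => B.card = m, t B =
      ∑ B ∈ Finset.univ.filter fun B : Finset (Fin M) => B.card = m, t' B) :
    singletonDefect t = singletonDefect t' := by
  have key : ∀ t : Finset (Fin M) → ℝ, singletonDefect t = M -
      ∑ B ∈ Finset.univ.filter fun B : Finset (Fin M) => B.card = 1, t B := by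
    intro t
    have : (Finset.univ.filter fun B : Finset (Fin M) => B.card = 1) =
        Finset.univ.image fun i : Fin M => ({i} : Finset (Fin M)) := by
      ext B
      simp [Finset.card_eq_one, eq_comm]
    rw [this, Finset.sum_image fun i _ j _ hij => Finset.singleton_injective hij]
    simp [singletonDefect]
  rw [key t, key t', h 1]

theorem sum_filter_card_sizeAverage (t : Finset (Fin M) → ℝ) (m : ℕ) :
    ∑ B ∈ Finset.univ.filter fun B : Finset (Fin M) => B.card = m, sizeAverage t B =
      ∑ B ∈ Finset.univ.filter fun B : Finset (Fin M) => B.card = m, t B := by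
  rcases (Finset.univ.filter fun B : Finset (Fin M) => B.card = m).eq_empty_or_nonempty with h | h
  · rw [h]; simp
  · have hc : ∀ B ∈ Finset.univ.filter fun B : Finset (Fin M) => B.card = m, sizeAverage t B =
        (∑ B ∈ Finset.univ.filter fun B : Finset (Fin M) => B.card = m, t B) /
          (Finset.univ.filter fun B : Finset (Fin M) => B.card = m).card := by
      intro B hB
      have hB' := (Finset.mem_filter.1 hB).2
      unfold sizeAverage
      rw [hB']
    rw [Finset.sum_congr rfl hc, Finset.sum_const, nsmul_eq_mul, mul_div_cancel₀]
    exact_mod_cast h.card_pos.ne'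

end FeatureAllocation

/-! ### Generating functional of the construction -/

theorem integral_prod_infinitePi {ι κ X : Type*} [Fintype κ] [MeasurableSpace X]
    (μ : ι → Measure X) [∀ i, IsProbabilityMeasure (μ i)] {g : κ → ι} (hg : g.Injective)
    {f : κ → X → ℝ} (hf : ∀ j, Measurable (f j)) :
    ∫ ω, ∏ j, f j (ω (g j)) ∂Measure.infinitePi μ = ∏ j, ∫ x, f j x ∂μ (g j) := by
  have h1 : Measurable fun (ω : ι → X) (j : κ) => ω (g j) := by fun_prop
  have h2 : Measurable fun x : κ → X => ∏ j, f j (x j) :=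
    Finset.measurable_prod _ fun j _ => (hf j).comp (measurable_pi_apply j)
  have h3 := integral_map (μ := Measure.infinitePi μ) h1.aemeasurable h2.aestronglyMeasurable
  rw [Measure.map_infinitePi_infinitePi_of_inj hg, Measure.infinitePi_eq_pi,
    integral_fintype_prod_eq_prod] at h3
  exact h3.symm

theorem integral_pow_poissonMeasure (r : ℝ≥0) (c : ℝ) :
    ∫ n, c ^ n ∂poissonMeasure r = Real.exp (-(r * (1 - c))) := by
  rw [integral_poissonMeasure]
  have : ∀ n : ℕ, (Real.exp (-r) * (r : ℝ) ^ n / n.factorial) • c ^ n =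
      Real.exp (-r) * ((r * c) ^ n / n.factorial) := by
    intro n
    rw [smul_eq_mul, mul_pow]; ring
  simp_rw [this]
  rw [tsum_mul_left, ← congrFun NormedSpace.exp_eq_tsum_div (r * c), ← Real.exp_eq_exp_ℝ,
    ← Real.exp_add]
  congr 1; ring

namespace FeatureFrequency

open FeatureAllocation Filter Topology

variable {M : ℕ}

/-- The probability of a draw for a feature with frequency `v`. -/
def drawProb (v : ℝ) (b : Prop) [Decidable b] : ℝ := if b then v else 1 - v

theorem prod_drawProb (v : ℝ) (B : Finset (Fin M)) :
    ∏ i, drawProb v (i ∈ B) = v ^ B.card * (1 - v) ^ (M - B.card) := by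
  simp only [drawProb]
  rw [Finset.prod_ite, Finset.prod_const, Finset.prod_const, Finset.filter_not,
    Finset.card_sdiff_of_subset (Finset.filter_subset _ _)]
  simp

theorem integral_draws (θ : Param) {K : ℕ} (b : Fin K → Prop) [∀ k, Decidable (b k)] (c : ℝ) :
    ∫ x, (∏ k : Fin K, if x.1 k = decide (b k) then 1 else 0) * c ^ x.2 ∂indexLaw θ =
      (∏ k : Fin K, drawProb (θ.1 k) (b k)) * Real.exp (-(θ.2 * (1 - c))) := by
  rw [indexLaw, integral_prod_mul (fun x : ℕ → Bool => ∏ k : Fin K,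
    if x k = decide (b k) then (1 : ℝ) else 0) fun y : ℕ => c ^ y, integral_pow_poissonMeasure,
    integral_prod_infinitePi (fun k => bernoulliMeasure true false (θ.1 k)) Fin.val_injective
      (f := fun (k : Fin K) (x : Bool) => if x = decide (b k) then (1 : ℝ) else 0)
      fun k => Measurable.of_discrete]
  congr 1
  refine Finset.prod_congr rfl fun k _ => ?_
  rw [integral_bernoulliMeasure]
  by_cases h : b k <;> simp [drawProb, h]

theorem apply_block_eq_sum (t : Finset (Fin M) → ℝ) (ω : Sample) (k : ℕ) :
    t (block ω M k) = ∑ B : Finset (Fin M), t B *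
      ∏ i : Fin M, if (ω i).1 k = decide (i ∈ B) then 1 else 0 := by
  rw [Finset.sum_eq_single (block ω M k)]
  · rw [Finset.prod_eq_one, mul_one]
    intro i _
    simp [block]
  · intro B _ hB
    obtain ⟨i, hi⟩ : ∃ i : Fin M, ¬ (ω i).1 k = decide (i ∈ B) := by
      by_contra! hc
      refine hB ?_
      ext i
      simp [block, hc i]
    rw [Finset.prod_eq_zero (Finset.mem_univ i) (if_neg hi), mul_zero]
  · simp

/-- The functional of the features with the first `K` labels and the Poisson singletons. -/
def partialWeight (t : Finset (Fin M) → ℝ) (K : ℕ) (ω : Sample) : ℝ :=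
  (∏ k : Fin K, t (block ω M k)) * ∏ i : Fin M, t {i} ^ (ω i).2

/-- The draws are independent over the indices `i`, but the factors `t (block ω M k)` mix them.
Expanding over all possible `K`-tuples of blocks turns each summand into a product over `i`; after
integration the sum is folded back into a product over `k`. -/
theorem integral_partialWeight (t : Finset (Fin M) → ℝ) (K : ℕ) (θ : Param)
    (ht : ∀ A, 0 ≤ t A) (ht1 : ∀ A, t A ≤ 1) :
    ∫ ω, partialWeight t K ω ∂sampleLaw θ =
      (∏ k : Fin K, bern t (θ.1 k)) * Real.exp (-(θ.2 * singletonDefect t)) := by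
  classical
  let g : (Fin K → Finset (Fin M)) → Fin M → (ℕ → Bool) × ℕ → ℝ := fun B i x =>
    (∏ k : Fin K, if x.1 k = decide (i ∈ B k) then 1 else 0) * t {i} ^ x.2
  have hg : ∀ B i, Measurable (g B i) := by
    intro B i
    refine Measurable.mul (Finset.measurable_prod _ fun k _ => ?_) ?_
    · exact (Measurable.of_discrete (f := fun b : Bool =>
        if b = decide (i ∈ B k) then (1 : ℝ) else 0)).comp (by fun_prop)
    · exact (Measurable.of_discrete (f := fun n : ℕ => t {i} ^ n)).comp measurable_snd
  have hg0 : ∀ B i x, 0 ≤ g B i x := fun B i x =>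
    mul_nonneg (Finset.prod_nonneg fun k _ => by split_ifs <;> norm_num) (pow_nonneg (ht _) _)
  have hg1 : ∀ B i x, g B i x ≤ 1 := fun B i x =>
    mul_le_one₀ (Finset.prod_le_one (fun k _ => by split_ifs <;> norm_num)
      fun k _ => by split_ifs <;> norm_num) (pow_nonneg (ht _) _) (pow_le_one₀ (ht _) (ht1 _))
  have hexp : ∀ ω : Sample, partialWeight t K ω = ∑ B : Fin K → Finset (Fin M),
      (∏ k, t (B k)) * ∏ i : Fin M, g B i (ω i) := by
    intro ω
    rw [partialWeight]
    simp_rw [apply_block_eq_sum t ω]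
    rw [Finset.prod_univ_sum, Fintype.piFinset_univ, Finset.sum_mul]
    refine Finset.sum_congr rfl fun B _ => ?_
    rw [Finset.prod_mul_distrib, Finset.prod_comm, mul_assoc, ← Finset.prod_mul_distrib]
  simp_rw [hexp]
  rw [integral_finsetSum]
  · have hterm : ∀ B : Fin K → Finset (Fin M),
        ∫ ω, (∏ k, t (B k)) * ∏ i : Fin M, g B i (ω i) ∂sampleLaw θ =
        (∏ k, t (B k) * ((θ.1 k : ℝ) ^ (B k).card * (1 - θ.1 k) ^ (M - (B k).card))) *
          Real.exp (-(θ.2 * singletonDefect t)) := by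
      intro B
      rw [integral_const_mul, sampleLaw, integral_prod_infinitePi (fun _ : ℕ => indexLaw θ)
        Fin.val_injective (hg B)]
      have : ∀ i, ∫ x, g B i x ∂indexLaw θ = (∏ k : Fin K, drawProb (θ.1 k) (i ∈ B k)) *
          Real.exp (-(θ.2 * (1 - t {i}))) := fun i =>
        integral_draws θ (fun k => i ∈ B k) (t {i})
      simp_rw [this]
      rw [Finset.prod_mul_distrib, Finset.prod_comm, ← Real.exp_sum, ← mul_assoc,
        ← Finset.prod_mul_distrib]
      simp_rw [prod_drawProb]
      rw [Finset.sum_neg_distrib, ← Finset.mul_sum, singletonDefect]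
    simp_rw [hterm]
    rw [← Finset.sum_mul]
    congr 1
    simp only [bern]
    rw [Finset.prod_univ_sum, Fintype.piFinset_univ]
  · intro B _
    refine Integrable.const_mul ?_ _
    refine .of_bound (Measurable.aestronglyMeasurable ?_) 1 (ae_of_all _ fun ω => ?_)
    · exact Finset.measurable_prod _ fun i _ => (hg B i).comp (measurable_pi_apply _)
    · rw [Real.norm_eq_abs, abs_of_nonneg (Finset.prod_nonneg fun i _ => hg0 B i _)]
      exact Finset.prod_le_one (fun i _ => hg0 B i _) fun i _ => hg1 B i _

theorem measurable_partialWeight (t : Finset (Fin M) → ℝ) (K : ℕ) :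
    Measurable (partialWeight t K) := by
  have : partialWeight t K = (fun x : Fin M → (Fin K → Bool) × ℕ =>
      (∏ k : Fin K, t (Finset.univ.filter fun i => (x i).1 k = true)) *
        ∏ i : Fin M, t {i} ^ (x i).2) ∘ fun ω i => (fun k => (ω i).1 k, (ω i).2) := rfl
  rw [this]
  exact Measurable.of_discrete.comp (by fun_prop)

/-- Only finitely many blocks meet `[M]`, and the empty ones contribute the factor `t ∅ = 1`. -/
theorem weight_generated {t : Finset (Fin M) → ℝ} (ht : t ∅ = 1) (ω : Sample)
    (hω : LocallyFinite ω) :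
    ∀ᶠ K in atTop, partialWeight t K ω = weight t ((generated ω hω).level M) := by
  obtain ⟨K₀, h⟩ := (generated_level_eq_iff ω hω M _).1 rfl
  filter_upwards [eventually_ge_atTop K₀] with K hK
  rw [weight, ← h K hK, Multiset.map_add, Multiset.prod_add, partialWeight]
  congr 1
  · rw [Multiset.map_map]
    change _ = ∏ k ∈ _, t (block ω M k)
    rw [Fin.prod_univ_eq_prod_range (fun k => t (block ω M k)) K, Finset.prod_filter]
    refine Finset.prod_congr rfl fun k _ => ?_
    split_ifs with hk
    · rfl
    · rw [Finset.not_nonempty_iff_eq_empty.1 hk, ht]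
  · rw [← Multiset.coe_mapAddMonoidHom, map_sum, Multiset.prod_sum]
    simp

/-- The generating functional of the features of `[M]`, given the parameters. -/
def condWeight (t : Finset (Fin M) → ℝ) (θ : Param) : ℝ :=
  Real.exp (∑' k, logBern t (θ.1 k)) *
    Real.exp (-((θ.2 + ∑' k, (θ.1 k : ℝ)) * singletonDefect t))

/-- The first Borel–Cantelli lemma, for each index separately. -/
theorem ae_locallyFinite {θ : Param} (hθ : Summable fun k => (θ.1 k : ℝ)) :
    ∀ᵐ ω ∂sampleLaw θ, LocallyFinite ω := by
  rw [show (∀ᵐ ω ∂sampleLaw θ, LocallyFinite ω) ↔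
    ∀ᵐ ω ∂sampleLaw θ, ∀ n, {k | (ω n).1 k = true}.Finite from Iff.rfl, ae_all_iff]
  intro n
  refine ae_finite_setOfPred_mem (s := fun k => {ω : Sample | (ω n).1 k = true}) ?_
  have hmeas : ∀ k, sampleLaw θ {ω : Sample | (ω n).1 k = true} = ENNReal.ofReal (θ.1 k) := by
    intro k
    have h1 : {ω : Sample | (ω n).1 k = true} =
        (fun ω : Sample => ω n) ⁻¹' (((fun x : ℕ → Bool => x k) ⁻¹' {true}) ×ˢ Set.univ) := by
      ext; simp
    rw [h1, ← Measure.map_apply (by fun_prop)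
      (((measurable_pi_apply k) (MeasurableSet.of_discrete)).prod .univ), sampleLaw,
      Measure.infinitePi_map_eval, indexLaw, Measure.prod_prod, measure_univ, mul_one,
      ← Measure.map_apply (by fun_prop) .of_discrete, Measure.infinitePi_map_eval,
      bernoulliMeasure_apply_of_mem_of_notMem _ (by simp) (by simp) (by simp), ENNReal.ofReal,
      Real.toNNReal_of_nonneg (θ.1 k).2.1]
    rfl
  simp_rw [hmeas]
  rw [← ENNReal.ofReal_tsum_of_nonneg (fun k => (θ.1 k).2.1) hθ]
  exact ENNReal.ofReal_ne_top

/-- Dominated convergence as the number of labels grows. Moving the linear part of each `log (bern t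
(V_k))` into the Poisson exponent makes the formula depend on `λ` only through `λ + ∑ V_k`. -/
theorem integral_weight_allocation {t : Finset (Fin M) → ℝ} (h : IsTest t) {θ : Param}
    (hθ : Summable fun k => (θ.1 k : ℝ)) :
    ∫ ω, weight t ((allocation ω).level M) ∂sampleLaw θ = condWeight t θ := by
  have hlim : Tendsto (fun K => ∫ ω, partialWeight t K ω ∂sampleLaw θ) atTop
      (𝓝 (∫ ω, weight t ((allocation ω).level M) ∂sampleLaw θ)) := by
    refine tendsto_integral_of_dominated_convergence (fun _ => 1)
      (fun K => (measurable_partialWeight t K).aestronglyMeasurable) (integrable_const 1)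
      (fun K => ae_of_all _ fun ω => ?_) ?_
    · have h1 : ∀ i : Fin M, 0 ≤ t {i} ^ (ω i).2 := fun i => pow_nonneg (h.pos _).le _
      have h2 : 0 ≤ ∏ k : Fin K, t (block ω M k) := Finset.prod_nonneg fun k _ => (h.pos _).le
      rw [Real.norm_eq_abs, partialWeight, abs_of_nonneg
        (mul_nonneg h2 (Finset.prod_nonneg fun i _ => h1 i))]
      exact mul_le_one₀ (Finset.prod_le_one (fun k _ => (h.pos _).le) fun k _ => h.le_one _)
        (Finset.prod_nonneg fun i _ => h1 i)
        (Finset.prod_le_one (fun i _ => h1 i) fun i _ => pow_le_one₀ (h.pos _).le (h.le_one _))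
    · filter_upwards [ae_locallyFinite hθ] with ω hω
      rw [allocation, dif_pos hω]
      exact tendsto_const_nhds.congr' ((weight_generated h.empty ω hω).mono fun K hK => hK.symm)
  refine tendsto_nhds_unique hlim ?_
  simp_rw [integral_partialWeight t _ θ (fun A => (h.pos A).le) h.le_one]
  have h1 : ∀ K : ℕ, ∏ k : Fin K, bern t (θ.1 k) =
      Real.exp (∑ k ∈ Finset.range K, logBern t (θ.1 k)) *
        Real.exp (-((∑ k ∈ Finset.range K, (θ.1 k : ℝ)) * singletonDefect t)) := by
    intro K
    rw [Fin.prod_univ_eq_prod_range (fun k => bern t (θ.1 k)) K, Real.exp_sum, Finset.sum_mul,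
      ← Finset.sum_neg_distrib, Real.exp_sum, ← Finset.prod_mul_distrib]
    refine Finset.prod_congr rfl fun k _ => ?_
    rw [bern_eq_exp h (θ.1 k).2.1 (θ.1 k).2.2, mul_comm (singletonDefect t)]
  simp_rw [h1]
  have h2 : condWeight t θ = Real.exp (∑' k, logBern t (θ.1 k)) *
      Real.exp (-((∑' k, (θ.1 k : ℝ)) * singletonDefect t)) *
        Real.exp (-(θ.2 * singletonDefect t)) := by
    rw [condWeight, mul_assoc, ← Real.exp_add (-((∑' k, (θ.1 k : ℝ)) * singletonDefect t))]
    congr 2; ring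
  rw [h2]
  refine Tendsto.mul_const _ (Tendsto.mul ?_ ?_)
  · exact (Real.continuous_exp.tendsto _).comp (summable_logBern h hθ).hasSum.tendsto_sum_nat
  · exact (Real.continuous_exp.tendsto _).comp ((hθ.hasSum.tendsto_sum_nat.mul_const _).neg)

theorem condWeight_congr {t t' : Finset (Fin M) → ℝ}
    (h : ∀ m, ∑ B ∈ Finset.univ.filter fun B : Finset (Fin M) => B.card = m, t B =
      ∑ B ∈ Finset.univ.filter fun B : Finset (Fin M) => B.card = m, t' B) :
    condWeight t = condWeight t' := by
  ext θ
  simp only [condWeight, logBern, bern_congr_size h, singletonDefect_congr_size h]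

/-! ### The law of the construction -/

theorem IsParamLaw.isProbabilityMeasure_bind {Q : Measure Param} (hQ : IsParamLaw Q) :
    IsProbabilityMeasure (Q.bind sampleKernel) := by
  have := hQ.isProbabilityMeasure
  infer_instance

theorem IsParamLaw.isProbabilityMeasure_allocationLaw {Q : Measure Param} (hQ : IsParamLaw Q) :
    IsProbabilityMeasure (allocationLaw Q) := by
  have := hQ.isProbabilityMeasure_bind
  exact Measure.isProbabilityMeasure_map measurable_allocation.aemeasurable

theorem IsParamLaw.ae_locallyFinite {Q : Measure Param} (hQ : IsParamLaw Q) :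
    ∀ᵐ ω ∂(Q.bind sampleKernel), LocallyFinite ω := by
  rw [Measure.ae_comp_iff measurableSet_locallyFinite]
  filter_upwards [hQ.summable] with θ hθ
  exact FeatureFrequency.ae_locallyFinite hθ

theorem IsParamLaw.integral_weight {Q : Measure Param} (hQ : IsParamLaw Q)
    {t : Finset (Fin M) → ℝ} (h : IsTest t) :
    ∫ F, weight t F ∂((allocationLaw Q).map fun F => F.level M) = ∫ θ, condWeight t θ ∂Q := by
  have := hQ.isProbabilityMeasure
  have := hQ.isProbabilityMeasure_bind
  have hm : Measurable fun ω => (allocation ω).level M :=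
    (FeatureAllocationSeq.measurable_level M).comp measurable_allocation
  rw [allocationLaw, Measure.map_map (FeatureAllocationSeq.measurable_level M)
    measurable_allocation]
  refine (integral_map (f := weight t) hm.aemeasurable
    Measurable.of_discrete.aestronglyMeasurable).trans ?_
  have hint : Integrable (fun ω => weight t ((allocation ω).level M)) (Q.bind sampleKernel) :=
    .of_bound ((Measurable.of_discrete (f := weight t)).comp hm).aestronglyMeasurable 1
      (ae_of_all _ fun ω => h.norm_weight_le_one _)
  -- Viewing the mixture as a composition of kernels lets the integral be computed conditionally on
  -- the parameters.
  have hbind : Q.bind sampleKernel = (sampleKernel ∘ₖ Kernel.const Unit Q) () := by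
    rw [Kernel.comp_apply, Kernel.const_apply]
  rw [hbind] at hint
  refine (congrArg (fun ρ => ∫ ω, weight t ((allocation ω).level M) ∂ρ) hbind).trans
    ((Kernel.integral_comp hint).trans ?_)
  rw [Kernel.const_apply]
  refine integral_congr_ae ?_
  filter_upwards [hQ.summable] with θ hθ
  exact integral_weight_allocation h hθ

/-- The construction is exchangeable. -/
theorem IsParamLaw.isExchangeable {Q : Measure Param} (hQ : IsParamLaw Q) :
    FeatureAllocationSeq.IsExchangeable (allocationLaw Q) := by
  have := hQ.isProbabilityMeasure_allocationLaw
  intro N σ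
  have hp : Measurable (permute σ : FeatureAllocation N → FeatureAllocation N) := .of_discrete
  have hm := FeatureAllocationSeq.measurable_level N
  have : IsProbabilityMeasure ((allocationLaw Q).map fun F => (F.level N).permute σ) :=
    Measure.isProbabilityMeasure_map (hp.comp hm).aemeasurable
  refine measure_ext_of_weight fun t ht => ?_
  -- Relabelling the features amounts to relabelling the argument of `t`, which preserves its sum
  -- over the sets of each size.
  let e : Finset (Fin N) → Finset (Fin N) := fun A => A.map σ.toEmbedding
  have hte : IsTest (t ∘ e) :=
    { empty := by simp [e, ht.empty]
      pos := fun _ => ht.pos _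
      le_one := fun _ => ht.le_one _
      lt_one := fun A hA => ht.lt_one _ hA.map }
  have hw : ∀ F : FeatureAllocation N, weight t (F.permute σ) = weight (t ∘ e) F := by
    intro F
    simp [weight, permute, e]
  have hmap : (allocationLaw Q).map (fun F => (F.level N).permute σ) =
      ((allocationLaw Q).map fun F => F.level N).map (permute σ) := (Measure.map_map hp hm).symm
  rw [hmap, integral_map hp.aemeasurable Measurable.of_discrete.aestronglyMeasurable]
  simp_rw [hw]
  rw [hQ.integral_weight hte, hQ.integral_weight ht, condWeight_congr]
  intro m
  refine Finset.sum_equiv (Equiv.finsetCongr σ) (fun B => ?_) fun B _ => rfl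
  simp

/-- The construction has an EFPF. -/
theorem IsParamLaw.hasEFPF {Q : Measure Param} (hQ : IsParamLaw Q) :
    FeatureAllocationSeq.HasEFPF (allocationLaw Q) := by
  have := hQ.isProbabilityMeasure_allocationLaw
  refine FeatureAllocationSeq.hasEFPF_of_sizeAverage fun N t ht => ?_
  rw [hQ.integral_weight ht.sizeAverage, hQ.integral_weight ht,
    condWeight_congr (sum_filter_card_sizeAverage t)]

end FeatureFrequency

/-! ### Sampling without replacement against Bernoulli sampling -/

theorem abs_mul_sub_mul_le_of_le_one {a b c d : ℝ} (hb0 : 0 ≤ b) (hb : b ≤ 1) (hc0 : 0 ≤ c)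
    (hc : c ≤ 1) : |a * b - c * d| ≤ |a - c| + |b - d| := by
  have : a * b - c * d = (a - c) * b + c * (b - d) := by ring
  rw [this]
  refine (abs_add_le _ _).trans (add_le_add ?_ ?_)
  · rw [abs_mul, abs_of_nonneg hb0]
    exact mul_le_of_le_one_right (abs_nonneg _) hb
  · rw [abs_mul, abs_of_nonneg hc0]
    exact mul_le_of_le_one_left (abs_nonneg _) hc

theorem abs_prod_range_sub_pow_le {x : ℕ → ℝ} {v ε : ℝ} (n : ℕ) (h0 : ∀ j < n, 0 ≤ x j)
    (h1 : ∀ j < n, x j ≤ 1) (hv0 : 0 ≤ v) (hv1 : v ≤ 1) (h : ∀ j < n, |x j - v| ≤ ε) :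
    |∏ j ∈ Finset.range n, x j - v ^ n| ≤ n * ε := by
  induction n with
  | zero => simp
  | succ n ih =>
    rw [Finset.prod_range_succ, pow_succ]
    refine (abs_mul_sub_mul_le_of_le_one (h0 n (by omega)) (h1 n (by omega)) (pow_nonneg hv0 n)
      (pow_le_one₀ hv0 hv1)).trans ?_
    have := ih (fun j hj => h0 j (by omega)) (fun j hj => h1 j (by omega))
      fun j hj => h j (by omega)
    have := h n (by omega)
    push_cast
    linarith

theorem descFactorial_mul_div_eq {N m b c : ℕ} (hN : b + c ≤ N) :
    (m.descFactorial b * (N - m).descFactorial c : ℝ) / N.descFactorial (b + c) =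
      (∏ j ∈ Finset.range b, ((m - j : ℕ) : ℝ) / ((N : ℝ) - j)) *
        ∏ j ∈ Finset.range c, ((N - m - j : ℕ) : ℝ) / ((N : ℝ) - b - j) := by
  have h1 : (N.descFactorial (b + c) : ℝ) = (∏ j ∈ Finset.range b, ((N : ℝ) - j)) *
      ∏ j ∈ Finset.range c, ((N : ℝ) - b - j) := by
    rw [Nat.descFactorial_eq_prod_range, Finset.prod_range_add]
    push_cast
    congr 1
    · refine Finset.prod_congr rfl fun j hj => ?_
      have := Finset.mem_range.1 hj
      rw [Nat.cast_sub (by omega)]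
    · refine Finset.prod_congr rfl fun j hj => ?_
      have := Finset.mem_range.1 hj
      rw [Nat.cast_sub (by omega)]
      push_cast; ring
  rw [h1, Nat.descFactorial_eq_prod_range, Nat.descFactorial_eq_prod_range, Finset.prod_div_distrib,
    Finset.prod_div_distrib, div_mul_div_comm]
  push_cast
  rfl

/-- The ratio is the probability that a uniform `m`-subset of `[N]` contains `b` given points and
misses `c` others. The factor `m / N` in the error is essential: the number of features is
unbounded, so errors must be summable against the frequencies. -/
theorem abs_hypergeometric_sub_le {N m b c : ℕ} (hm : m ≤ N) (hN : 2 * (b + c) ≤ N) (hN0 : 0 < N) :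
    |(m.descFactorial b * (N - m).descFactorial c : ℝ) / N.descFactorial (b + c) -
      (m / N : ℝ) ^ b * (1 - m / N) ^ c| ≤ 4 * (b + c) ^ 2 / N * (m / N) := by
  have hNr : (0 : ℝ) < N := by exact_mod_cast hN0
  have hmr : (m : ℝ) ≤ N := by exact_mod_cast hm
  have hm0 : (0 : ℝ) ≤ m := Nat.cast_nonneg m
  have hb0 : (0 : ℝ) ≤ b := Nat.cast_nonneg b
  have hc0 : (0 : ℝ) ≤ c := Nat.cast_nonneg c
  have hNbc : 2 * ((b : ℝ) + c) ≤ N := by exact_mod_cast hN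
  set v : ℝ := m / N with hv
  have hv0 : 0 ≤ v := by positivity
  have hv1 : v ≤ 1 := (div_le_one hNr).2 hmr
  have hvN : v * N = m := by rw [hv]; field_simp
  have hsub : ((N - m : ℕ) : ℝ) = N - m := Nat.cast_sub hm
  rcases Nat.eq_zero_or_pos b with rfl | hb
  · rw [descFactorial_mul_div_eq (by omega)]
    simp only [Finset.range_zero, Finset.prod_empty, one_mul, pow_zero, Nat.cast_zero, sub_zero,
      zero_add]
    have hden : ∀ j < c, (N : ℝ) / 2 ≤ N - j ∧ (0 : ℝ) ≤ j ∧ (j : ℝ) ≤ c := fun j hj => by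
      have : (j : ℝ) ≤ c := by exact_mod_cast hj.le
      refine ⟨by linarith, Nat.cast_nonneg j, this⟩
    have hpos : ∀ j < c, (0 : ℝ) < N - j := fun j hj => by linarith [(hden j hj).1]
    -- For `b = 0` no factor `v` can be pulled out, but each factor differs from `1 - v` by at most
    -- `2 c v / N`.
    refine (abs_prod_range_sub_pow_le (ε := 2 * c / N * v) c (fun j hj =>
      div_nonneg (Nat.cast_nonneg _) (hpos j hj).le) (fun j hj => ?_) (by linarith) (by linarith)
        fun j hj => ?_).trans ?_
    · rw [div_le_one (hpos j hj), le_sub_iff_add_le]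
      have : j < N := by omega
      exact_mod_cast (by omega : N - m - j + j ≤ N)
    · have hp := hpos j hj
      obtain ⟨hd, hj0, hjc⟩ := hden j hj
      have hup : ((N - m - j : ℕ) : ℝ) / (N - j) ≤ 1 - v := by
        rw [div_le_iff₀ hp]
        rcases le_total j (N - m) with h | h
        · rw [Nat.cast_sub h, hsub]
          nlinarith
        · rw [Nat.sub_eq_zero_of_le h]
          push_cast
          exact mul_nonneg (by linarith) hp.le
      have hlow : 1 - v - 2 * c / N * v ≤ ((N - m - j : ℕ) : ℝ) / (N - j) := by
        rw [le_div_iff₀ hp]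
        have h2 : (N : ℝ) - m - j ≤ ((N - m - j : ℕ) : ℝ) := by
          rw [← hsub]
          have h3 : (N - m : ℕ) ≤ (N - m - j) + j := by omega
          have h4 : ((N - m : ℕ) : ℝ) ≤ ((N - m - j : ℕ) : ℝ) + j := by exact_mod_cast h3
          linarith
        refine le_trans ?_ h2
        have h3 : 2 * c / N * v * (N - j) ≥ j * v := by
          have : (2 * c / N * (N - j) : ℝ) ≥ j := by
            rw [ge_iff_le, div_mul_eq_mul_div, le_div_iff₀ hNr]
            nlinarith
          nlinarith
        nlinarith
      rw [abs_le]
      constructor <;> nlinarith [mul_nonneg (div_nonneg (mul_nonneg zero_le_two hc0) hNr.le) hv0]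
    · have : (0 : ℝ) ≤ c ^ 2 / N * v := by positivity
      have e : (c : ℝ) * (2 * c / N * v) = 2 * (c ^ 2 / N * v) := by ring
      have e' : 4 * (c : ℝ) ^ 2 / N * v = 4 * (c ^ 2 / N * v) := by ring
      rw [e, e']
      linarith
  · obtain ⟨b, rfl⟩ : ∃ b', b = b' + 1 := ⟨b - 1, by omega⟩
    have hb1 : (0 : ℝ) ≤ b := Nat.cast_nonneg b
    push_cast at hNbc hb0
    -- If the set is too small to contain the required points, the exact probability is `0` and `v`
    -- itself is of order `1 / N`.
    by_cases hmb : m < b + 1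
    · rw [Nat.descFactorial_eq_zero_iff_lt.2 hmb]
      simp only [Nat.cast_zero, zero_mul, zero_div, zero_sub, abs_neg]
      rw [abs_of_nonneg (mul_nonneg (pow_nonneg hv0 _) (pow_nonneg (by linarith) _))]
      refine (mul_le_of_le_one_right (pow_nonneg hv0 _) (pow_le_one₀ (by linarith)
        (by linarith))).trans ?_
      rcases Nat.eq_zero_or_pos b with rfl | hb
      · have h0 : v = 0 := by rw [hv, show m = 0 by omega]; simp
        simp [h0]
      · rw [pow_succ]
        refine mul_le_mul_of_nonneg_right ?_ hv0
        refine (pow_le_of_le_one hv0 hv1 hb.ne').trans ?_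
        rw [hv]
        have : (m : ℝ) ≤ b := by exact_mod_cast Nat.lt_succ_iff.1 hmb
        gcongr
        push_cast
        nlinarith
    · rw [descFactorial_mul_div_eq (by omega), Finset.prod_range_succ']
      -- The first factor equals `v` exactly and supplies the factor `m / N` of the bound; the
      -- others only need an error of order `1 / N`.
      have hx0 : ((m - 0 : ℕ) : ℝ) / (N - (0 : ℕ)) = v := by simp [hv]
      rw [hx0, pow_succ, mul_right_comm, mul_right_comm (v ^ b), ← sub_mul, abs_mul,
        abs_of_nonneg hv0]
      refine mul_le_mul_of_nonneg_right ?_ hv0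
      have hε : (0 : ℝ) ≤ 2 * (b + 1 + c) / N := by positivity
      have hpx : ∀ j < b, (0 : ℝ) < N - (j + 1 : ℕ) := fun j hj => by
        have : (j : ℝ) ≤ b := by exact_mod_cast hj.le
        push_cast; linarith
      have hpy : ∀ j < c, (0 : ℝ) < N - (b + 1 : ℕ) - j ∧ (N : ℝ) / 2 ≤ N - (b + 1 : ℕ) - j :=
        fun j hj => by
          have : (j : ℝ) ≤ c := by exact_mod_cast hj.le
          push_cast; constructor <;> linarith
      have hx_nonneg : ∀ j < b, 0 ≤ ((m - (j + 1) : ℕ) : ℝ) / (N - (j + 1 : ℕ)) := fun j hj =>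
        div_nonneg (Nat.cast_nonneg _) (hpx j hj).le
      have hx_le : ∀ j < b, ((m - (j + 1) : ℕ) : ℝ) / (N - (j + 1 : ℕ)) ≤ 1 := fun j hj => by
        rw [div_le_one (hpx j hj), le_sub_iff_add_le]
        exact_mod_cast (by omega : m - (j + 1) + (j + 1) ≤ N)
      have hy_nonneg : ∀ j < c, 0 ≤ ((N - m - j : ℕ) : ℝ) / (N - (b + 1 : ℕ) - j) := fun j hj =>
        div_nonneg (Nat.cast_nonneg _) (hpy j hj).1.le
      have hy_le : ∀ j < c, ((N - m - j : ℕ) : ℝ) / (N - (b + 1 : ℕ) - j) ≤ 1 := fun j hj => by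
        rw [div_le_one (hpy j hj).1, le_sub_iff_add_le, le_sub_iff_add_le]
        exact_mod_cast (by omega : N - m - j + j + (b + 1) ≤ N)
      refine (abs_mul_sub_mul_le_of_le_one (Finset.prod_nonneg fun j hj =>
        hy_nonneg j (Finset.mem_range.1 hj)) (Finset.prod_le_one (fun j hj =>
        hy_nonneg j (Finset.mem_range.1 hj)) fun j hj => hy_le j (Finset.mem_range.1 hj))
        (pow_nonneg hv0 _) (pow_le_one₀ hv0 hv1)).trans ?_
      have hX := abs_prod_range_sub_pow_le (ε := 2 * (b + 1 + c) / N) b hx_nonneg hx_le hv0 hv1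
        fun j hj => by
          have hjb : (j : ℝ) + 1 ≤ b := by exact_mod_cast hj
          have hj0 : (0 : ℝ) ≤ j := Nat.cast_nonneg j
          have hp := hpx j hj
          have hup : ((m - (j + 1) : ℕ) : ℝ) / (N - (j + 1 : ℕ)) ≤ v := by
            rw [div_le_iff₀ hp]
            rw [Nat.cast_sub (by omega)]
            push_cast
            nlinarith
          have hlow : v - 2 * (b + 1 + c) / N ≤ ((m - (j + 1) : ℕ) : ℝ) / (N - (j + 1 : ℕ)) := by
            have h1 : v - 2 * (b + 1 + c) / N ≤ ((m - (j + 1) : ℕ) : ℝ) / N := by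
              rw [hv, ← sub_div, Nat.cast_sub (by omega)]
              push_cast
              gcongr
              linarith
            refine h1.trans (div_le_div_of_nonneg_left (Nat.cast_nonneg _) hp ?_)
            push_cast; linarith
          rw [abs_le]
          constructor <;> linarith
      have hY := abs_prod_range_sub_pow_le (ε := 2 * (b + 1 + c) / N) (v := 1 - v) c hy_nonneg hy_le
        (by linarith) (by linarith) fun j hj => by
          have hjc : (j : ℝ) ≤ c := by exact_mod_cast hj.le
          have hj0 : (0 : ℝ) ≤ j := Nat.cast_nonneg j
          obtain ⟨hp, hp2⟩ := hpy j hj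
          have hnum : (N : ℝ) - m - j ≤ ((N - m - j : ℕ) : ℝ) := by
            rw [← hsub]
            have h4 : ((N - m : ℕ) : ℝ) ≤ ((N - m - j : ℕ) : ℝ) + j := by
              exact_mod_cast (by omega : (N - m : ℕ) ≤ (N - m - j) + j)
            linarith
          have hnum2 : ((N - m - j : ℕ) : ℝ) ≤ N - m := by
            rw [← hsub]
            exact_mod_cast Nat.sub_le _ _
          have hεN : 2 * (b + 1 + c) / N * (N - (b + 1 : ℕ) - j) ≥ (b + 1 + c : ℝ) := by
            rw [ge_iff_le, div_mul_eq_mul_div, le_div_iff₀ hNr]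
            nlinarith
          have hvd : v * (N - (b + 1 : ℕ) - j) ≤ m ∧
              m ≤ v * (N - (b + 1 : ℕ) - j) + (b + 1 + c) := by
            have e : v * (N - (b + 1 : ℕ) - j) = m - v * ((b + 1 : ℕ) + j) := by
              rw [← hvN]; ring
            have h5 : v * ((b + 1 : ℕ) + j) ≤ (b + 1 : ℕ) + j :=
              mul_le_of_le_one_left (by positivity) hv1
            have h6 : 0 ≤ v * ((b + 1 : ℕ) + j) := by positivity
            push_cast at e h5 h6 ⊢
            constructor <;> linarith
          have hup : ((N - m - j : ℕ) : ℝ) / (N - (b + 1 : ℕ) - j) ≤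
              1 - v + 2 * (b + 1 + c) / N := by
            rw [div_le_iff₀ hp, add_mul, sub_mul]
            push_cast at hεN hvd ⊢
            linarith [hvd.1]
          have hlow : 1 - v - 2 * (b + 1 + c) / N ≤
              ((N - m - j : ℕ) : ℝ) / (N - (b + 1 : ℕ) - j) := by
            rw [le_div_iff₀ hp, sub_mul, sub_mul]
            push_cast at hεN hvd ⊢
            linarith [hvd.2]
          rw [abs_le]
          constructor <;> linarith
      refine (add_le_add hX hY).trans ?_
      have e : (b : ℝ) * (2 * (b + 1 + c) / N) + c * (2 * (b + 1 + c) / N) =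
          2 * ((b + c) * (b + 1 + c)) / N := by ring
      rw [e]
      push_cast
      refine div_le_div_of_nonneg_right ?_ hNr.le
      nlinarith [mul_nonneg hb1 hc0]

namespace FeatureAllocation

variable {M N : ℕ}

/-- A set with trace `B` is determined by its part outside `[M]`, which may be any set of the
remaining size. -/
theorem card_filter_trace_eq (h : M ≤ N) (B : Finset (Fin M)) (m : ℕ) :
    (Finset.univ.filter fun A : Finset (Fin N) => A.card = m ∧ trace h A = B).card =
      if B.card ≤ m then (N - M).choose (m - B.card) else 0 := by
  let e : Fin M ↪ Fin N := ⟨Fin.castLE h, Fin.castLE_injective h⟩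
  let R : Finset (Fin N) := Finset.univ.map e
  have hmem : ∀ (A : Finset (Fin N)) (i : Fin M), i ∈ trace h A ↔ e i ∈ A := fun A i => by
    simp [trace, e]
  have hsplit : ∀ A : Finset (Fin N), A = (trace h A).map e ∪ A \ R := by
    intro A
    ext x
    simp only [Finset.mem_union, Finset.mem_map, Finset.mem_sdiff, hmem, R, Finset.mem_univ,
      true_and]
    constructor
    · intro hx
      by_cases hxR : ∃ i, e i = x
      · obtain ⟨i, rfl⟩ := hxR
        exact Or.inl ⟨i, hx, rfl⟩
      · exact Or.inr ⟨hx, hxR⟩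
    · rintro (⟨i, hi, rfl⟩ | ⟨hx, -⟩)
      · exact hi
      · exact hx
  have hdisj : ∀ A : Finset (Fin N), ∀ C : Finset (Fin M), Disjoint (C.map e) (A \ R) := by
    intro A C
    refine Finset.disjoint_left.2 fun x hx hx' => (Finset.mem_sdiff.1 hx').2 ?_
    exact Finset.map_subset_map.2 (Finset.subset_univ C) hx
  have hcard : ∀ A : Finset (Fin N), A.card = (trace h A).card + (A \ R).card := by
    intro A
    conv_lhs => rw [hsplit A]
    rw [Finset.card_union_of_disjoint (hdisj A _), Finset.card_map]
  split_ifs with hB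
  · have hR : (Rᶜ : Finset (Fin N)).card = N - M := by
      rw [Finset.card_compl, Finset.card_map]; simp
    rw [← hR, ← Finset.card_powersetCard]
    refine Finset.card_nbij' (fun A => A \ R) (fun C => B.map e ∪ C) ?_ ?_ ?_ ?_
    · intro A hA
      obtain ⟨h1, h2⟩ := (Finset.mem_filter.1 hA).2
      have := hcard A
      rw [h2] at this
      refine Finset.mem_coe.2 (Finset.mem_powersetCard.2 ⟨?_, by
        change (A \ R).card = _
        omega⟩)
      intro x hx
      exact Finset.mem_compl.2 (Finset.mem_sdiff.1 hx).2
    · intro C hC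
      obtain ⟨h1, h2⟩ := Finset.mem_powersetCard.1 hC
      have hd : Disjoint (B.map e) C := by
        refine Finset.disjoint_left.2 fun x hx hx' => Finset.mem_compl.1 (h1 hx') ?_
        exact Finset.map_subset_map.2 (Finset.subset_univ B) hx
      refine Finset.mem_coe.2 (Finset.mem_filter.2 ⟨Finset.mem_univ _, ?_, ?_⟩)
      · rw [Finset.card_union_of_disjoint hd, Finset.card_map]; omega
      · ext i
        rw [hmem, Finset.mem_union, Finset.mem_map' e]
        refine or_iff_left fun hi => Finset.mem_compl.1 (h1 hi) ?_
        exact Finset.mem_map_of_mem e (Finset.mem_univ i)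
    · intro A hA
      obtain ⟨-, h2⟩ := (Finset.mem_filter.1 hA).2
      simp only
      rw [← h2, ← hsplit A]
    · intro C hC
      obtain ⟨h1, -⟩ := Finset.mem_powersetCard.1 hC
      ext x
      simp only [Finset.mem_sdiff, Finset.mem_union]
      constructor
      · rintro ⟨hx | hx, hx'⟩
        · exact absurd (Finset.map_subset_map.2 (Finset.subset_univ B) hx) hx'
        · exact hx
      · exact fun hx => ⟨Or.inr hx, Finset.mem_compl.1 (h1 hx)⟩
  · rw [Finset.card_eq_zero, Finset.filter_eq_empty_iff]
    rintro A - ⟨h1, h2⟩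
    have := hcard A
    rw [h2] at this
    omega

/-- Both sides count the `m`-subsets of `[N]` together with `b` distinct ordered points inside and
`c` distinct ordered points outside. -/
theorem choose_mul_descFactorial {N m b c : ℕ} (hm : m ≤ N) (hN : b + c ≤ N) :
    (if b ≤ m then (N - (b + c)).choose (m - b) else 0) * N.descFactorial (b + c) =
      N.choose m * (m.descFactorial b * (N - m).descFactorial c) := by
  split_ifs with hb
  · by_cases hc : c ≤ N - m
    · obtain ⟨i, rfl⟩ := Nat.exists_eq_add_of_le hb
      obtain ⟨j, hj⟩ := Nat.exists_eq_add_of_le hc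
      have h1 := Nat.factorial_mul_descFactorial hN
      have h2 := Nat.factorial_mul_descFactorial hb
      have h3 := Nat.factorial_mul_descFactorial hc
      have h4 := Nat.choose_mul_factorial_mul_factorial hm
      have e1 : N - (b + c) = i + j := by omega
      have e2 : b + i - b = i := by omega
      have e3 : N - (b + i) - c = j := by omega
      rw [e1] at h1 ⊢
      rw [e2] at h2 ⊢
      rw [e3] at h3
      have h5 := Nat.add_choose_mul_factorial_mul_factorial i j
      rw [← Nat.choose_symm_add] at h5
      refine Nat.eq_of_mul_eq_mul_right (Nat.mul_pos i.factorial_pos j.factorial_pos) ?_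
      calc (i + j).choose i * N.descFactorial (b + c) * (i.factorial * j.factorial)
          = ((i + j).choose i * i.factorial * j.factorial) * N.descFactorial (b + c) := by ring
        _ = N.choose (b + i) * (b + i).factorial * (N - (b + i)).factorial := by
            rw [h5, h1, h4]
        _ = _ := by rw [← h2, ← h3]; ring
    · rw [Nat.choose_eq_zero_of_lt (by omega), Nat.descFactorial_eq_zero_iff_lt.2
        (show N - m < c by omega)]
      simp
  · rw [Nat.descFactorial_eq_zero_iff_lt.2 (show m < b by omega)]
    simp

/-- Sampling without replacement from a large set is close to sampling with replacement. -/
theorem exists_abs_sizeAverage_sub_le {t : Finset (Fin M) → ℝ} (ht : IsTest t) :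
    ∃ C, 0 ≤ C ∧ ∀ N, ∀ h : M ≤ N, 2 * M ≤ N → 0 < N → ∀ A : Finset (Fin N),
      |sizeAverage (t ∘ trace h) A - bern t (A.card / N)| ≤ C / N * (A.card / N) := by
  refine ⟨∑ B : Finset (Fin M), 4 * (M : ℝ) ^ 2, by positivity, fun N h hN hN0 A => ?_⟩
  have hA : A.card ≤ N := by simpa using Finset.card_le_univ A
  have hcardA : (Finset.univ.filter fun B : Finset (Fin N) => B.card = A.card).card =
      N.choose A.card := by
    rw [Finset.univ_filter_card_eq, Finset.card_powersetCard]; simp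
  -- Grouping the sets of size `|A|` by their trace gives an expectation under hypergeometric
  -- probabilities.
  have hsum : sizeAverage (t ∘ trace h) A = ∑ B : Finset (Fin M), t B *
      ((A.card.descFactorial B.card * (N - A.card).descFactorial (M - B.card) : ℝ) /
        N.descFactorial (B.card + (M - B.card))) := by
    rw [sizeAverage, hcardA, ← Finset.sum_fiberwise_of_maps_to (t := Finset.univ) (g := trace h)
      fun _ _ => Finset.mem_univ _, Finset.sum_div]
    refine Finset.sum_congr rfl fun B _ => ?_
    have hB : B.card + (M - B.card) = M := by
      have : B.card ≤ M := by simpa using Finset.card_le_univ B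
      omega
    rw [Finset.sum_congr rfl (g := fun _ => t B) fun A' hA' => by
      rw [Function.comp_apply, (Finset.mem_filter.1 hA').2], Finset.sum_const, nsmul_eq_mul,
      Finset.filter_filter, card_filter_trace_eq h]
    have hch := choose_mul_descFactorial (b := B.card) (c := M - B.card) hA (by omega)
    rw [hB] at hch ⊢
    have hch' := congrArg (Nat.cast : ℕ → ℝ) hch
    rw [Nat.cast_mul, Nat.cast_mul, Nat.cast_mul] at hch'
    have hpos : (N.choose A.card : ℝ) ≠ 0 := by exact_mod_cast (Nat.choose_pos hA).ne'
    have hpos' : (N.descFactorial M : ℝ) ≠ 0 := by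
      exact_mod_cast (Nat.descFactorial_pos.2 h).ne'
    rw [mul_comm, mul_div_assoc]
    congr 1
    rw [div_eq_div_iff hpos hpos', hch', mul_comm]
  rw [hsum, bern, ← Finset.sum_sub_distrib, Finset.sum_div, Finset.sum_mul]
  refine (Finset.abs_sum_le_sum_abs _ _).trans (Finset.sum_le_sum fun B _ => ?_)
  have hB : B.card + (M - B.card) = M := by
    have : B.card ≤ M := by simpa using Finset.card_le_univ B
    omega
  rw [← mul_sub, abs_mul, abs_of_pos (ht.pos B)]
  refine (mul_le_of_le_one_left (abs_nonneg _) (ht.le_one B)).trans ?_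
  have := abs_hypergeometric_sub_le (b := B.card) (c := M - B.card) hA (by omega) hN0
  rw [← Nat.cast_add, hB] at this
  rw [hB]
  exact this

end FeatureAllocation

/-! ### The compact parameter space and the limiting functional -/

namespace FeatureFrequency

open FeatureAllocation Filter Topology

variable {M N : ℕ}

/-- A compact space of parameters: the decreasing frequencies `v`, together with `exp (-S)`, where
`S ∈ [0, ∞]` is an upper bound of `∑ v`. -/
def paramSpace : Set ((ℕ → unitInterval) × unitInterval) :=
  {x | Antitone x.1 ∧ ∀ n, (x.2 : ℝ) * Real.exp (∑ k ∈ Finset.range n, (x.1 k : ℝ)) ≤ 1}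

/-- Each condition involves finitely many coordinates. The full sum is only lower semicontinuous,
which is why the definition asks for an inequality. -/
theorem isClosed_paramSpace : IsClosed paramSpace := by
  have : paramSpace = (⋂ i : ℕ, ⋂ j : ℕ, ⋂ _ : i ≤ j, {x | x.1 j ≤ x.1 i}) ∩
      ⋂ n : ℕ, {x | (x.2 : ℝ) * Real.exp (∑ k ∈ Finset.range n, (x.1 k : ℝ)) ≤ 1} := by
    ext x
    simp [paramSpace, Antitone]
  rw [this]
  refine (isClosed_iInter fun i => isClosed_iInter fun j => isClosed_iInter fun _ =>
    isClosed_le (by fun_prop) (by fun_prop)).inter (isClosed_iInter fun n =>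
    isClosed_le ?_ continuous_const)
  fun_prop

instance : CompactSpace paramSpace := isCompact_iff_compactSpace.1 isClosed_paramSpace.isCompact

section

variable {x : (ℕ → unitInterval) × unitInterval}

theorem sum_range_le_neg_log (hx : x ∈ paramSpace) (hu : 0 < (x.2 : ℝ)) (n : ℕ) :
    ∑ k ∈ Finset.range n, (x.1 k : ℝ) ≤ -Real.log x.2 := by
  have h := Real.log_le_log (by positivity) (hx.2 n)
  rw [Real.log_mul hu.ne' (Real.exp_pos _).ne', Real.log_exp, Real.log_one] at h
  linarith

theorem summable_of_mem_paramSpace (hx : x ∈ paramSpace) (hu : 0 < (x.2 : ℝ)) :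
    Summable fun k => (x.1 k : ℝ) :=
  summable_of_sum_range_le (fun k => (x.1 k).2.1) (sum_range_le_neg_log hx hu)

theorem tsum_le_neg_log (hx : x ∈ paramSpace) (hu : 0 < (x.2 : ℝ)) :
    ∑' k, (x.1 k : ℝ) ≤ -Real.log x.2 :=
  Real.tsum_le_of_sum_range_le (fun k => (x.1 k).2.1) (sum_range_le_neg_log hx hu)

/-- Monotonicity gives `(k + 1) v_k ≤ v_0 + ⋯ + v_k`. The squares of the frequencies are thus
dominated by a summable sequence, uniformly while `u` stays away from `0`. -/
theorem coe_le_neg_log_div (hx : x ∈ paramSpace) (hu : 0 < (x.2 : ℝ)) (k : ℕ) :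
    (x.1 k : ℝ) ≤ -Real.log x.2 / (k + 1) := by
  rw [le_div_iff₀ (by positivity)]
  refine le_trans ?_ (sum_range_le_neg_log hx hu (k + 1))
  have : ∑ _j ∈ Finset.range (k + 1), (x.1 k : ℝ) ≤ ∑ j ∈ Finset.range (k + 1), (x.1 j : ℝ) :=
    Finset.sum_le_sum fun j hj => hx.1 (Nat.lt_succ_iff.1 (Finset.mem_range.1 hj))
  rw [Finset.sum_const, Finset.card_range, nsmul_eq_mul] at this
  push_cast at this
  linarith

/-- The frequencies and the Poisson rate for a point of the compact parameter space. -/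
def toParam (x : (ℕ → unitInterval) × unitInterval) : Param :=
  (x.1, Real.toNNReal (-Real.log x.2 - ∑' k, (x.1 k : ℝ)))

theorem measurable_toParam : Measurable toParam := by
  refine measurable_fst.prodMk (Measurable.real_toNNReal (Measurable.sub ?_ ?_))
  · exact (Real.measurable_log.comp (measurable_subtype_coe.comp measurable_snd)).neg
  · exact Measurable.tsum fun k => by fun_prop

/-- The generating functional of the features of `[M]` as a function on the compact parameter
space. -/
def limitWeight (t : Finset (Fin M) → ℝ) (x : (ℕ → unitInterval) × unitInterval) : ℝ :=
  (x.2 : ℝ) ^ singletonDefect t * Real.exp (∑' k, logBern t (x.1 k))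

/-- The Poisson rate is exactly the excess of `-log u` over the sum of the frequencies. -/
theorem condWeight_toParam (t : Finset (Fin M) → ℝ) (hx : x ∈ paramSpace) (hu : 0 < (x.2 : ℝ)) :
    condWeight t (toParam x) = limitWeight t x := by
  have h : (((toParam x).2 : ℝ) + ∑' k, (x.1 k : ℝ)) = -Real.log x.2 := by
    rw [toParam, Real.coe_toNNReal _ (sub_nonneg.2 (tsum_le_neg_log hx hu))]
    ring
  rw [condWeight, limitWeight, mul_comm, Real.rpow_def_of_pos hu]
  simp only [toParam] at h ⊢
  rw [h]
  ring_nf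

theorem logBern_le {t : Finset (Fin M) → ℝ} (ht : IsTest t) (hM : M ≠ 0) {τ : ℝ} (hτ : τ < 1)
    (h : ∀ B, B.Nonempty → t B ≤ τ) {v : ℝ} (h0 : 0 ≤ v) (h1 : v ≤ 1) :
    logBern t v ≤ (singletonDefect t - (1 - τ)) * v := by
  have := Real.log_le_sub_one_of_pos (ht.bern_pos h0 h1)
  have := bern_le hM hτ.le ht.empty h h0 h1
  rw [logBern]
  linarith

theorem le_singletonDefect {t : Finset (Fin M) → ℝ} (ht : IsTest t) (hM : M ≠ 0) {τ : ℝ}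
    (h : ∀ B, B.Nonempty → t B ≤ τ) : 1 - τ ≤ singletonDefect t := by
  let i : Fin M := ⟨0, Nat.pos_of_ne_zero hM⟩
  refine le_trans ?_ (Finset.single_le_sum (f := fun i => 1 - t {i})
    (fun j _ => sub_nonneg.2 (ht.le_one {j})) (Finset.mem_univ i))
  have := h {i} (Finset.singleton_nonempty i)
  linarith

theorem singletonDefect_pos {t : Finset (Fin M) → ℝ} (ht : IsTest t) (hM : M ≠ 0) :
    0 < singletonDefect t := by
  obtain ⟨τ, -, h1, h⟩ := ht.exists_upper_bound
  exact (sub_pos.2 h1).trans_le (le_singletonDefect ht hM h)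

theorem limitWeight_nonneg (t : Finset (Fin M) → ℝ) : 0 ≤ limitWeight t x :=
  mul_nonneg (Real.rpow_nonneg x.2.2.1 _) (Real.exp_pos _).le

/-- At `u = 0` the series may diverge, but the power of `u` vanishes because its exponent is
positive; this needs `M ≠ 0`. -/
theorem limitWeight_of_eq_zero {t : Finset (Fin M) → ℝ} (ht : IsTest t) (hM : M ≠ 0)
    (hu : (x.2 : ℝ) = 0) : limitWeight t x = 0 := by
  rw [limitWeight, hu, Real.zero_rpow (singletonDefect_pos ht hM).ne', zero_mul]

/-- The linear bound on `logBern` costs at most `(a - (1 - τ)) S` in the exponent, where `a =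
singletonDefect t` and `S = -log u`. Against `exp (-a S)` this leaves `exp (-(1 - τ) S)`, which
tends to `0` with `u`. -/
theorem limitWeight_le {t : Finset (Fin M) → ℝ} (ht : IsTest t) (hM : M ≠ 0) {τ : ℝ} (hτ : τ < 1)
    (h : ∀ B, B.Nonempty → t B ≤ τ) (hx : x ∈ paramSpace) :
    limitWeight t x ≤ (x.2 : ℝ) ^ (1 - τ) := by
  rcases x.2.2.1.eq_or_lt with hu | hu
  · rw [limitWeight_of_eq_zero ht hM hu.symm]
    exact Real.rpow_nonneg x.2.2.1 _
  · have hs := summable_of_mem_paramSpace hx hu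
    have h1 : ∑' k, logBern t (x.1 k) ≤ (singletonDefect t - (1 - τ)) * -Real.log x.2 := by
      refine ((summable_logBern ht hs).tsum_le_tsum (fun k =>
        logBern_le ht hM hτ h (x.1 k).2.1 (x.1 k).2.2) (hs.mul_left _)).trans ?_
      rw [tsum_mul_left]
      exact mul_le_mul_of_nonneg_left (tsum_le_neg_log hx hu)
        (sub_nonneg.2 (le_singletonDefect ht hM h))
    rw [limitWeight, Real.rpow_def_of_pos hu, Real.rpow_def_of_pos hu, ← Real.exp_add,
      Real.exp_le_exp]
    linarith

theorem limitWeight_le_one {t : Finset (Fin M) → ℝ} (ht : IsTest t) (hM : M ≠ 0)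
    (hx : x ∈ paramSpace) : limitWeight t x ≤ 1 := by
  obtain ⟨τ, -, h1, h⟩ := ht.exists_upper_bound
  exact (limitWeight_le ht hM h1 h hx).trans
    (Real.rpow_le_one x.2.2.1 x.2.2.2 (sub_nonneg.2 h1.le))

theorem continuous_logBern_apply {t : Finset (Fin M) → ℝ} (ht : IsTest t) (k : ℕ) :
    Continuous fun x : (ℕ → unitInterval) × unitInterval => logBern t (x.1 k) := by
  have h : Continuous fun x : (ℕ → unitInterval) × unitInterval => (x.1 k : ℝ) := by fun_prop
  exact (((continuous_bern t).comp h).log fun x => (ht.bern_pos (x.1 k).2.1 (x.1 k).2.2).ne').add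
    (h.const_mul _)

theorem continuousOn_limitWeight {t : Finset (Fin M) → ℝ} (ht : IsTest t) (hM : M ≠ 0) :
    ContinuousOn (limitWeight t) paramSpace := by
  have hu : Continuous fun x : (ℕ → unitInterval) × unitInterval => (x.2 : ℝ) := by fun_prop
  intro x hx
  rcases x.2.2.1.eq_or_lt with hx0 | hx0
  -- At `u = 0` the functional is squeezed between `0` and `u ^ (1 - τ)`.
  · obtain ⟨τ, -, h1, h⟩ := ht.exists_upper_bound
    have hlim : Tendsto (fun y : (ℕ → unitInterval) × unitInterval => (y.2 : ℝ) ^ (1 - τ))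
        (𝓝[paramSpace] x) (𝓝 0) := by
      have hc := ((Real.continuous_rpow_const (sub_nonneg.2 h1.le)).comp hu).continuousWithinAt
        (s := paramSpace) (x := x)
      have h0 : ((fun y : ℝ => y ^ (1 - τ)) ∘ fun y : (ℕ → unitInterval) × unitInterval =>
          (y.2 : ℝ)) x = 0 := by
        simp only [Function.comp_apply]
        rw [← hx0, Real.zero_rpow (sub_pos.2 h1).ne']
      rw [ContinuousWithinAt, h0] at hc
      exact hc
    rw [ContinuousWithinAt, limitWeight_of_eq_zero ht hM hx0.symm]
    exact tendsto_of_tendsto_of_tendsto_of_le_of_le' tendsto_const_nhds hlim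
      (Eventually.of_forall fun y => limitWeight_nonneg t)
      (eventually_mem_nhdsWithin.mono fun y hy => limitWeight_le ht hM h1 h hy)
  -- Near a point with `u > 0`, the bounds `|logBern t v| ≤ C v²` and `v_k ≤ s / (k + 1)` give
  -- uniform convergence of the series.
  · set U : Set ((ℕ → unitInterval) × unitInterval) := {y | (x.2 : ℝ) / 2 < y.2} with hU
    have hUo : IsOpen U := isOpen_lt continuous_const hu
    have hxU : x ∈ U := half_lt_self hx0
    obtain ⟨C, hC, hCb⟩ := exists_abs_logBern_le ht
    set s : ℝ := -Real.log ((x.2 : ℝ) / 2) with hs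
    have hcont : ContinuousOn (fun y : (ℕ → unitInterval) × unitInterval =>
        ∑' k, logBern t (y.1 k)) (paramSpace ∩ U) := by
      refine continuousOn_tsum (u := fun k : ℕ => C * s ^ 2 * (1 / ((k : ℝ) + 1) ^ 2))
        (fun k => (continuous_logBern_apply ht k).continuousOn) ?_ ?_
      · refine Summable.mul_left _ ?_
        have := (summable_nat_add_iff 1).2 (Real.summable_one_div_nat_pow.2 one_lt_two)
        simpa using this
      · rintro k y ⟨hy, hyU⟩
        have hy0 : 0 < (y.2 : ℝ) := (half_pos hx0).trans hyU
        have h1 : (y.1 k : ℝ) ≤ s / (k + 1) := by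
          refine (coe_le_neg_log_div hy hy0 k).trans ?_
          have := Real.log_le_log (half_pos hx0) (le_of_lt hyU)
          gcongr
          rw [hs]; linarith
        refine (hCb _ (y.1 k).2.1 (y.1 k).2.2).trans ?_
        rw [mul_assoc]
        refine mul_le_mul_of_nonneg_left ?_ hC
        refine (pow_le_pow_left₀ (y.1 k).2.1 h1 2).trans (le_of_eq ?_)
        rw [div_pow]; ring
    have hfull : ContinuousOn (limitWeight t) (paramSpace ∩ U) :=
      (((Real.continuous_rpow_const (singletonDefect_nonneg ht)).comp hu).continuousOn).mul
        (Real.continuous_exp.comp_continuousOn hcont)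
    exact (hfull x ⟨hx, hxU⟩).mono_of_mem_nhdsWithin
      (inter_mem_nhdsWithin _ (hUo.mem_nhds hxU))

end

/-! ### The empirical frequencies of a feature allocation of `[N]` -/

/-- The fraction of the elements of `[N]` that belong to `A`. -/
def frequency (A : Finset (Fin N)) : unitInterval :=
  ⟨A.card / N, by positivity, div_le_one_of_le₀ (by
    exact_mod_cast (by simpa using Finset.card_le_univ A : A.card ≤ N)) (by positivity)⟩

theorem hasSum_getD {f : unitInterval → ℝ} (hf : f 0 = 0) (L : List unitInterval) :
    HasSum (fun k => f (L.getD k 0)) (L.map f).sum := by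
  induction L with
  | nil => simp [hf, hasSum_zero]
  | cons a L ih =>
    rw [List.map_cons, List.sum_cons]
    have := (hasSum_nat_add_iff (f := fun k => f ((a :: L).getD k 0)) 1).1 (by simpa using ih)
    simpa [add_comm] using this

theorem antitone_getD {L : List unitInterval} (hL : L.Pairwise (· ≥ ·)) :
    Antitone fun k => L.getD k 0 := by
  intro i j hij
  rcases lt_or_ge j L.length with hj | hj
  · simp only [List.getD_eq_getElem _ _ hj, List.getD_eq_getElem _ _ (hij.trans_lt hj)]
    rcases hij.eq_or_lt with rfl | hlt
    · exact le_rfl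
    · exact List.pairwise_iff_getElem.1 hL i j _ hj hlt
  · simp only [List.getD_eq_default _ _ hj]
    exact unitInterval.nonneg _

/-- The frequencies of the features of `F`, in decreasing order. -/
def sortedFrequencies (F : FeatureAllocation N) : List unitInterval :=
  (F.features.map frequency).sort (· ≥ ·)

theorem sum_map_sortedFrequencies (F : FeatureAllocation N) (f : unitInterval → ℝ) :
    ((sortedFrequencies F).map f).sum = (F.features.map fun A => f (frequency A)).sum := by
  rw [← Multiset.sum_coe, ← Multiset.map_coe, sortedFrequencies, Multiset.sort_eq,
    Multiset.map_map]
  rfl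

/-- The mean number of features of `F` that contain a uniformly random element of `[N]`. -/
def totalFrequency (F : FeatureAllocation N) : ℝ := (F.features.map fun A => (frequency A : ℝ)).sum

theorem totalFrequency_nonneg (F : FeatureAllocation N) : 0 ≤ totalFrequency F := by
  refine Multiset.sum_nonneg fun x hx => ?_
  obtain ⟨A, -, rfl⟩ := Multiset.mem_map.1 hx
  exact (frequency A).2.1

/-- The point of the compact parameter space given by the frequencies of the features of `F`. -/
def empiricalParam (F : FeatureAllocation N) : paramSpace :=
  ⟨(fun k => (sortedFrequencies F).getD k 0, ⟨Real.exp (-totalFrequency F), (Real.exp_pos _).le,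
    Real.exp_le_one_iff.2 (neg_nonpos.2 (totalFrequency_nonneg F))⟩), by
    refine ⟨antitone_getD (Multiset.pairwise_sort _ _), fun n => ?_⟩
    have h := hasSum_getD (f := fun v => (v : ℝ)) (by simp) (sortedFrequencies F)
    rw [sum_map_sortedFrequencies F fun v => (v : ℝ)] at h
    have h2 := h.summable.sum_le_tsum (Finset.range n)
      fun k _ => ((sortedFrequencies F).getD k 0).2.1
    rw [h.tsum_eq] at h2
    simp only
    rw [← Real.exp_add, Real.exp_le_one_iff, totalFrequency]
    linarith⟩

/-- For a finite list the coordinate `u` is `exp (-∑ v)` exactly, so no mass is lost and the linear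
parts recombine with `logBern`. -/
theorem limitWeight_empiricalParam {t : Finset (Fin M) → ℝ} (ht : IsTest t)
    (F : FeatureAllocation N) :
    limitWeight t (empiricalParam F) = (F.features.map fun A => bern t (frequency A)).prod := by
  have h := (hasSum_getD (f := fun v => logBern t v) (by simp [logBern_zero ht])
    (sortedFrequencies F)).tsum_eq
  rw [sum_map_sortedFrequencies F fun v => logBern t v] at h
  rw [limitWeight]
  simp only [empiricalParam]
  rw [h, ← Real.exp_mul, ← Real.exp_add, totalFrequency]
  induction F.features using Multiset.induction with
  | empty => simp
  | cons A s ih =>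
    simp only [Multiset.map_cons, Multiset.sum_cons, Multiset.prod_cons]
    rw [← ih, bern_eq_exp ht (frequency A).2.1 (frequency A).2.2, ← Real.exp_add, ← Real.exp_add]
    congr 1; ring

end FeatureFrequency

/-! ### Comparison of products with an unbounded number of factors -/

section MultisetProd

variable {α : Type*} {g h v : α → ℝ} {c ε : ℝ}

theorem multiset_prod_map_nonneg (h0 : ∀ a, 0 ≤ h a) (s : Multiset α) : 0 ≤ (s.map h).prod := by
  refine Multiset.prod_nonneg fun x hx => ?_
  obtain ⟨a, -, rfl⟩ := Multiset.mem_map.1 hx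
  exact h0 a

theorem multiset_prod_map_le_exp (h0 : ∀ a, 0 ≤ h a) (h1 : ∀ a, h a ≤ Real.exp (-(c * v a)))
    (s : Multiset α) : (s.map h).prod ≤ Real.exp (-(c * (s.map v).sum)) := by
  induction s using Multiset.induction with
  | empty => simp
  | cons a s ih =>
    simp only [Multiset.map_cons, Multiset.prod_cons, Multiset.sum_cons]
    rw [mul_add, neg_add, Real.exp_add]
    exact mul_le_mul (h1 a) ih (multiset_prod_map_nonneg h0 s) (Real.exp_pos _).le

theorem abs_multiset_prod_sub_le (hh0 : ∀ a, 0 ≤ h a) (hh1 : ∀ a, h a ≤ 1) (hg0 : ∀ a, 0 ≤ g a)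
    (hg1 : ∀ a, g a ≤ 1) (hgh : ∀ a, |h a - g a| ≤ ε * v a) (s : Multiset α) :
    |(s.map h).prod - (s.map g).prod| ≤ ε * (s.map v).sum := by
  induction s using Multiset.induction with
  | empty => simp
  | cons a s ih =>
    simp only [Multiset.map_cons, Multiset.prod_cons, Multiset.sum_cons]
    refine (abs_mul_sub_mul_le_of_le_one (multiset_prod_map_nonneg hh0 s)
      (FeatureAllocation.multiset_prod_map_le_one hh0 hh1 s) (hg0 a) (hg1 a)).trans ?_
    rw [mul_add]
    exact add_le_add (hgh a) ih

/-- A bound for the difference of two products that does not depend on the number of factors. -/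
theorem abs_multiset_prod_sub_le_sqrt (hc : 0 < c) (hv : ∀ a, 0 ≤ v a) (hh0 : ∀ a, 0 ≤ h a)
    (hh1 : ∀ a, h a ≤ Real.exp (-(c * v a))) (hg0 : ∀ a, 0 ≤ g a)
    (hg1 : ∀ a, g a ≤ Real.exp (-(c * v a))) (hgh : ∀ a, |h a - g a| ≤ ε * v a) (hε : 0 ≤ ε)
    (s : Multiset α) : |(s.map h).prod - (s.map g).prod| ≤ Real.sqrt (ε / c) := by
  have hle : ∀ a, Real.exp (-(c * v a)) ≤ 1 := fun a =>
    Real.exp_le_one_iff.2 (neg_nonpos.2 (mul_nonneg hc.le (hv a)))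
  have hD1 := abs_multiset_prod_sub_le hh0 (fun a => (hh1 a).trans (hle a)) hg0
    (fun a => (hg1 a).trans (hle a)) hgh s
  have hPh := multiset_prod_map_le_exp hh0 hh1 s
  have hPg := multiset_prod_map_le_exp hg0 hg1 s
  have hPh0 := multiset_prod_map_nonneg hh0 s
  have hPg0 := multiset_prod_map_nonneg hg0 s
  have hS0 : 0 ≤ (s.map v).sum := by
    refine Multiset.sum_nonneg fun x hx => ?_
    obtain ⟨a, -, rfl⟩ := Multiset.mem_map.1 hx
    exact hv a
  have hD2 : |(s.map h).prod - (s.map g).prod| ≤ Real.exp (-(c * (s.map v).sum)) :=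
    abs_le.2 ⟨by linarith, by linarith⟩
  set D := |(s.map h).prod - (s.map g).prod|
  set S := (s.map v).sum
  refine Real.le_sqrt_of_sq_le ?_
  -- The telescoping bound `ε S` is good for small `S`, the bound `exp (-c S)` for large `S`; their
  -- product is bounded uniformly in `S`.
  have h1 : D ^ 2 ≤ ε * S * Real.exp (-(c * S)) := by
    rw [sq]
    exact mul_le_mul hD1 hD2 (abs_nonneg _) (mul_nonneg hε hS0)
  have h2 : c * S * Real.exp (-(c * S)) ≤ 1 := by
    rw [Real.exp_neg, ← div_eq_mul_inv, div_le_one (Real.exp_pos _)]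
    linarith [Real.add_one_le_exp (c * S)]
  refine h1.trans ?_
  rw [le_div_iff₀ hc]
  nlinarith

end MultisetProd

/-! ### The converse: limits of the empirical parameters -/

namespace FeatureFrequency

open FeatureAllocation FeatureAllocationSeq Filter Topology

variable {M : ℕ}

/-- Strictness is lost: a non-empty subset of `[N]` that misses `[M]` gets the value `1`. -/
theorem isWeight_comp_trace {t : Finset (Fin M) → ℝ} (ht : IsTest t) {N : ℕ} (h : M ≤ N) :
    IsWeight (t ∘ trace h) where
  empty := by
    have : trace h ∅ = ∅ := by ext; simp [trace]
    simp [this, ht.empty]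
  pos _ := ht.pos _
  le_one _ := ht.le_one _

/-- The generating functional of the features of `[M]` is the limit of its values for the empirical
frequencies of the features of `[N]`. -/
theorem tendsto_integral_limitWeight {μ : Measure FeatureAllocationSeq} [IsProbabilityMeasure μ]
    (hμ : HasEFPF μ) (hM : M ≠ 0) {t : Finset (Fin M) → ℝ} (ht : IsTest t) :
    Tendsto (fun N => ∫ F, limitWeight t (empiricalParam (F.level N)) ∂μ) atTop
      (𝓝 (∫ F, weight t (F.level M) ∂μ)) := by
  obtain ⟨C, hC, hCb⟩ := exists_abs_sizeAverage_sub_le ht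
  obtain ⟨τ, -, hτ, hτb⟩ := ht.exists_upper_bound
  -- `bern t v ≤ 1 - 2 c v`; half of this decay absorbs the sampling error `C v / N` once `C / N <
  -- c`, so both factors are at most `exp (-c v)`.
  set c : ℝ := (1 - τ) / 2 with hc
  have hc0 : 0 < c := by rw [hc]; linarith
  have hlim0 : Tendsto (fun N : ℕ => C / (N : ℝ)) atTop (𝓝 0) :=
    tendsto_const_div_atTop_nhds_zero_nat C
  have hlim : Tendsto (fun N : ℕ => Real.sqrt (C / (N : ℝ) / c)) atTop (𝓝 0) := by
    have := ((hlim0.div_const c).sqrt)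
    simpa using this
  rw [tendsto_iff_norm_sub_tendsto_zero]
  refine squeeze_zero' (Eventually.of_forall fun N => norm_nonneg _) ?_ hlim
  filter_upwards [eventually_ge_atTop (2 * M), eventually_gt_atTop 0,
    hlim0.eventually (gt_mem_nhds hc0)] with N hN hN0 hNc
  have hMN : M ≤ N := by omega
  have hw := isWeight_comp_trace ht hMN
  have hm := measurable_level N
  have h1 : ∫ F, weight t (F.level M) ∂μ =
      ∫ F, weight (sizeAverage (t ∘ trace hMN)) (F.level N) ∂μ := by
    have e1 : ∀ F : FeatureAllocationSeq, weight t (F.level M) =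
        weight (t ∘ trace hMN) (F.level N) := fun F => by
      rw [← F.consistent M N hMN, weight_restrict hMN ht.empty]
    simp_rw [e1]
    have e2 := hμ.integral_weight_sizeAverage hw
    rw [integral_map hm.aemeasurable Measurable.of_discrete.aestronglyMeasurable,
      integral_map hm.aemeasurable Measurable.of_discrete.aestronglyMeasurable] at e2
    exact e2.symm
  have hbound : ∀ F : FeatureAllocation N,
      |limitWeight t (empiricalParam F) - weight (sizeAverage (t ∘ trace hMN)) F| ≤
        Real.sqrt (C / N / c) := by
    intro F
    rw [limitWeight_empiricalParam ht, abs_sub_comm, weight]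
    have hfreq : ∀ A : Finset (Fin N), (frequency A : ℝ) = A.card / N := fun A => rfl
    have hbern : ∀ A : Finset (Fin N), bern t (frequency A) ≤ 1 - 2 * c * frequency A := fun A => by
      refine (bern_le hM hτ.le ht.empty hτb (frequency A).2.1 (frequency A).2.2).trans ?_
      rw [hc]; linarith
    have hexp : ∀ A : Finset (Fin N), 1 - c * frequency A ≤ Real.exp (-(c * frequency A)) :=
      fun A => Real.one_sub_le_exp_neg _
    have hdiff : ∀ A : Finset (Fin N), |sizeAverage (t ∘ trace hMN) A - bern t (frequency A)| ≤
        C / N * frequency A := fun A => hCb N hMN hN hN0 A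
    refine abs_multiset_prod_sub_le_sqrt (v := fun A => (frequency A : ℝ)) hc0
      (fun A => (frequency A).2.1) (fun A => (hw.sizeAverage.pos A).le) (fun A => ?_)
      (fun A => (ht.bern_pos (frequency A).2.1 (frequency A).2.2).le) (fun A => ?_) hdiff
      (div_nonneg hC (Nat.cast_nonneg N)) F.features
    · have h2 := (abs_le.1 (hdiff A)).2
      have h3 := mul_le_mul_of_nonneg_right hNc.le (frequency A).2.1
      linarith [hbern A, hexp A]
    · have := mul_nonneg hc0.le (frequency A).2.1
      linarith [hbern A, hexp A]
  have hi1 : Integrable (fun F : FeatureAllocationSeq =>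
      limitWeight t (empiricalParam (F.level N))) μ :=
    .of_bound ((Measurable.of_discrete (f := fun F : FeatureAllocation N =>
      limitWeight t (empiricalParam F))).comp hm).aestronglyMeasurable 1 (ae_of_all _ fun F => by
        rw [Real.norm_eq_abs, abs_of_nonneg (limitWeight_nonneg t)]
        exact limitWeight_le_one ht hM (empiricalParam _).2)
  have hi2 : Integrable (fun F : FeatureAllocationSeq =>
      weight (sizeAverage (t ∘ trace hMN)) (F.level N)) μ :=
    .of_bound ((Measurable.of_discrete (f := weight (sizeAverage (t ∘ trace hMN)))).comp
      hm).aestronglyMeasurable 1 (ae_of_all _ fun F => hw.sizeAverage.norm_weight_le_one _)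
  rw [h1, ← integral_sub hi1 hi2]
  refine (norm_integral_le_of_norm_le_const (ae_of_all _ fun F => hbound (F.level N))).trans ?_
  simp

/-- There is a law on the compact parameter space that represents the generating functionals. -/
theorem exists_limit_law {μ : Measure FeatureAllocationSeq} [IsProbabilityMeasure μ]
    (hμ : HasEFPF μ) : ∃ Q : Measure paramSpace, IsProbabilityMeasure Q ∧
      ∀ M, M ≠ 0 → ∀ t : Finset (Fin M) → ℝ, IsTest t →
        ∫ x : paramSpace, limitWeight t x ∂Q = ∫ F, weight t (F.level M) ∂μ := by
  have hm : ∀ N, Measurable fun F : FeatureAllocationSeq => empiricalParam (F.level N) := fun N =>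
    (Measurable.of_discrete (f := fun F : FeatureAllocation N => empiricalParam F)).comp
      (measurable_level N)
  let q : ℕ → ProbabilityMeasure paramSpace := fun N =>
    ⟨μ.map fun F => empiricalParam (F.level N),
      Measure.isProbabilityMeasure_map (hm N).aemeasurable⟩
  -- Probability measures on a compact metrizable space form a compact space, so the laws converge
  -- along any ultrafilter; a non-principal one preserves limits at infinity.
  obtain ⟨Q, -, hQ⟩ := (isCompact_univ (X := ProbabilityMeasure paramSpace)).ultrafilter_le_nhds
    ((hyperfilter ℕ).map q) (by simp)
  refine ⟨Q, inferInstance, fun M hM t ht => ?_⟩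
  have hcont := (continuousOn_limitWeight ht hM).domRestrict
  have h1 := (ProbabilityMeasure.tendsto_iff_forall_integral_tendsto.1
    (show Tendsto q (hyperfilter ℕ) (𝓝 Q) from hQ))
    (BoundedContinuousFunction.mkOfCompact ⟨_, hcont⟩)
  have h2 := (tendsto_integral_limitWeight hμ hM ht).mono_left Nat.hyperfilter_le_atTop
  refine tendsto_nhds_unique h1 (h2.congr fun N => ?_)
  exact (integral_map (hm N).aemeasurable hcont.measurable.aestronglyMeasurable).symm

theorem weight_const {N : ℕ} (c : ℝ) (F : FeatureAllocation N) :
    weight (fun A => if A = ∅ then 1 else c) F = c ^ F.features.card := by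
  rw [weight, Multiset.map_congr rfl (g := fun _ => c) fun A hA => if_neg (F.nonempty A hA).ne_empty]
  simp

/-- The functional vanishes where `u = 0` and is at most `1` elsewhere, so each of its integrals is
a lower bound for `Q (u > 0)`. For `M = 1` and a constant value `c` tending to `1` at the non-empty
set, these integrals are `E c ^ (number of features of F_1)`, which tend to `1` because that number
is finite. -/
theorem ae_pos_of_limit_law {μ : Measure FeatureAllocationSeq} [IsProbabilityMeasure μ]
    {Q : Measure paramSpace} [IsProbabilityMeasure Q]
    (hQ : ∀ M, M ≠ 0 → ∀ t : Finset (Fin M) → ℝ, IsTest t →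
      ∫ x : paramSpace, limitWeight t x ∂Q = ∫ F, weight t (F.level M) ∂μ) :
    ∀ᵐ x : paramSpace ∂Q, 0 < (x.1.2 : ℝ) := by
  have hmeas : MeasurableSet {x : paramSpace | 0 < (x.1.2 : ℝ)} :=
    measurableSet_lt measurable_const (by fun_prop)
  let c : ℕ → ℝ := fun n => 1 - 1 / ((n : ℝ) + 2)
  have hc0 : ∀ n, 0 < c n := fun n => by
    have : 1 / ((n : ℝ) + 2) < 1 := by
      rw [div_lt_one (by positivity)]; linarith [Nat.cast_nonneg (α := ℝ) n]
    simp only [c]; linarith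
  have hc1 : ∀ n, c n < 1 := fun n => by
    have : 0 < 1 / ((n : ℝ) + 2) := by positivity
    simp only [c]; linarith
  have hclim : Tendsto c atTop (𝓝 1) := by
    have h1 : Tendsto (fun n : ℕ => 1 / ((n : ℝ) + 2)) atTop (𝓝 0) := by
      have := (tendsto_add_atTop_iff_nat 2).2 (tendsto_one_div_atTop_nhds_zero_nat (𝕜 := ℝ))
      simpa using this
    simpa [c] using h1.const_sub 1
  let t : ℕ → Finset (Fin 1) → ℝ := fun n A => if A = ∅ then 1 else c n
  have ht : ∀ n, IsTest (t n) := fun n =>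
    { empty := by simp [t]
      pos := fun A => by simp only [t]; split_ifs; exacts [one_pos, hc0 n]
      le_one := fun A => by simp only [t]; split_ifs; exacts [le_rfl, (hc1 n).le]
      lt_one := fun A hA => by simp only [t]; rw [if_neg hA.ne_empty]; exact hc1 n }
  have hlim : Tendsto (fun n => ∫ F, weight (t n) (F.level 1) ∂μ) atTop (𝓝 1) := by
    have : (1 : ℝ) = ∫ _F : FeatureAllocationSeq, 1 ∂μ := by simp
    rw [this]
    refine tendsto_integral_of_dominated_convergence (fun _ => 1) (fun n => ?_)
      (integrable_const 1) (fun n => ae_of_all _ fun F => (ht n).norm_weight_le_one _)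
      (ae_of_all _ fun F => ?_)
    · exact ((Measurable.of_discrete (f := weight (t n))).comp
        (measurable_level 1)).aestronglyMeasurable
    · simp only [t, weight_const]
      simpa using hclim.pow (F.level 1).features.card
  have hle : ∀ n, ∫ F, weight (t n) (F.level 1) ∂μ ≤ Q.real {x : paramSpace | 0 < (x.1.2 : ℝ)} := by
    intro n
    rw [← hQ 1 one_ne_zero (t n) (ht n), ← integral_indicator_one hmeas]
    refine integral_mono_of_nonneg (ae_of_all _ fun x => limitWeight_nonneg _)
      ((integrable_const (1 : ℝ)).indicator hmeas) (ae_of_all _ fun x => ?_)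
    by_cases hx : 0 < (x.1.2 : ℝ)
    · rw [Set.indicator_of_mem (by exact hx)]
      exact limitWeight_le_one (ht n) one_ne_zero x.2
    · rw [Set.indicator_of_notMem (by exact hx)]
      exact (limitWeight_of_eq_zero (ht n) one_ne_zero
        (le_antisymm (not_lt.1 hx) x.1.2.2.1)).le
  have h1 : Q.real {x : paramSpace | 0 < (x.1.2 : ℝ)} = 1 :=
    le_antisymm measureReal_le_one (le_of_tendsto' hlim hle)
  refine (mem_ae_iff_prob_eq_one hmeas).2 ?_
  rw [← ofReal_measureReal, h1, ENNReal.ofReal_one]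

theorem measurableSet_summable :
    MeasurableSet {θ : Param | Summable fun k => (θ.1 k : ℝ)} := by
  have : {θ : Param | Summable fun k => (θ.1 k : ℝ)} =
      ⋃ C : ℕ, ⋂ n : ℕ, {θ | ∑ k ∈ Finset.range n, (θ.1 k : ℝ) ≤ C} := by
    ext θ
    simp only [Set.mem_ofPred_eq, Set.mem_iUnion, Set.mem_iInter]
    constructor
    · intro h
      obtain ⟨C, hC⟩ := exists_nat_ge (∑' k, (θ.1 k : ℝ))
      exact ⟨C, fun n => (h.sum_le_tsum _ fun k _ => (θ.1 k).2.1).trans hC⟩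
    · rintro ⟨C, hC⟩
      exact summable_of_sum_range_le (fun k => (θ.1 k).2.1) hC
  rw [this]
  exact .iUnion fun C => .iInter fun n => measurableSet_le (by fun_prop) measurable_const

theorem measurable_condWeight (t : Finset (Fin M) → ℝ) : Measurable (condWeight t) := by
  have hk : ∀ k, Measurable fun θ : Param => (θ.1 k : ℝ) := fun k => by fun_prop
  have hb := (continuous_bern t).measurable
  refine Measurable.mul (Real.measurable_exp.comp (Measurable.tsum fun k => ?_))
    (Real.measurable_exp.comp (((measurable_snd.coe_nnreal_real).add
      (Measurable.tsum hk)).mul_const _).neg)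
  exact ((Real.measurable_log.comp (hb.comp (hk k))).add ((hk k).const_mul _))

/-- Every random feature allocation with an EFPF is obtained from a feature frequency model with
additional Poisson singletons. -/
theorem exists_isParamLaw {μ : Measure FeatureAllocationSeq} [IsProbabilityMeasure μ]
    (hμ : HasEFPF μ) : ∃ Q : Measure Param, IsParamLaw Q ∧ allocationLaw Q = μ := by
  obtain ⟨Q, hQp, hQ⟩ := exists_limit_law hμ
  have hpos := ae_pos_of_limit_law hQ
  have hf : Measurable fun x : paramSpace => toParam x :=
    measurable_toParam.comp measurable_subtype_coe
  have hlaw : IsParamLaw (Q.map fun x : paramSpace => toParam x) := by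
    refine ⟨Measure.isProbabilityMeasure_map hf.aemeasurable, ?_⟩
    rw [ae_map_iff hf.aemeasurable measurableSet_summable]
    filter_upwards [hpos] with x hx
    exact summable_of_mem_paramSpace x.2 hx
  refine ⟨_, hlaw, ?_⟩
  have := hlaw.isProbabilityMeasure_allocationLaw
  refine measure_ext_of_level fun M hM => measure_ext_of_weight fun t ht => ?_
  rw [hlaw.integral_weight ht, integral_map hf.aemeasurable
    (measurable_condWeight t).aestronglyMeasurable,
    integral_map (measurable_level M).aemeasurable Measurable.of_discrete.aestronglyMeasurable,
    ← hQ M (by omega) t ht]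
  refine integral_congr_ae ?_
  filter_upwards [hpos] with x hx
  exact condWeight_toParam t x.2 hx

end FeatureFrequency

end

theorem theorem5p3 :
    (∀ Q : Measure FeatureFrequency.Param, FeatureFrequency.IsParamLaw Q →
      IsProbabilityMeasure (FeatureFrequency.allocationLaw Q) ∧
      (∀ᵐ ω ∂(Q.bind FeatureFrequency.sampleKernel), FeatureFrequency.LocallyFinite ω) ∧
      FeatureAllocationSeq.IsExchangeable (FeatureFrequency.allocationLaw Q) ∧
      FeatureAllocationSeq.HasEFPF (FeatureFrequency.allocationLaw Q)) ∧
    (∀ μ : Measure FeatureAllocationSeq, IsProbabilityMeasure μ →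
      FeatureAllocationSeq.HasEFPF μ →
      ∃ Q : Measure FeatureFrequency.Param, FeatureFrequency.IsParamLaw Q ∧
        FeatureFrequency.allocationLaw Q = μ) := by
  refine ⟨fun Q hQ => ⟨hQ.isProbabilityMeasure_allocationLaw, hQ.ae_locallyFinite,
    hQ.isExchangeable, hQ.hasEFPF⟩, fun μ hμ h => ?_⟩
  exact FeatureFrequency.exists_isParamLaw h
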